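/- **Setting.** Let $X$ be a Riemann surface and $\Sigma\subset T^*X$ an $SL(3)$ spectral curve: in a local coordinate $z$ it is $\{c\,dz : c^3+a(z)c+b(z)=0\}$ with $a,b$ holomorphic, and all zeros of the discriminant $4a^3+27b^2$ are simple (so $\Sigma$ is smooth with simple branch points). Away from the branch points $\Sigma$ consists of three distinct holomorphic $1$-forms $\phi_1,\phi_2,\phi_3$ with $\phi_1+\phi_2+\phi_3=0$; put $\phi_{ij}=\phi_i-\phi_j$. The foliation lines $f_{ij}$ are the curves on which $\Re\phi_{ij}=0$. The caustic is the set of points, not branch points, at which the three foliations are tangent to each other. Away from the caustic, $(\Re\phi_1,\Re\phi_2,\Re\phi_3)$ are local flat coordinates with values in $\{x_1+x_2+x_3=0\}\subset\mathbb R^3$, and angles are measured in them. A *singular set* is a finite set $S\subset X$ containing all branch points, together with a choice, for each $p\in S$, of one of the three foliations $f_p$ at $p$; if $p$ is a branch point, $f_p$ is the foliation of the two sheets which come together at $p$. A *BPS state* for $S$ is a compact spectral network graph, that is, a map to $X$ from a nonempty finite graph with vertices of valence $1$ (endpoints) and $3$, circle components without vertices being allowed, such that: every edge is sent to a compact segment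 of a foliation line whose interior contains no branch point (a circle component to a closed foliation line); every endpoint is sent to a point $p\in S$, and the edge adjoining it is sent to a foliation line of the foliation $f_p$; every trivalent vertex is sent to a point, not a branch point and not on the caustic, at which its three edges leave along foliation lines making pairwise angles of $120^\circ$. **Proposition.** Let $S$ be a singular set which has no BPS states. Then there is a countable set $N\subset X$ such that the following holds for every point $p$ of the caustic with $p\notin N$ at which the caustic does not run along a foliation line (that is, no open arc of a foliation line through $p$ is contained in the caustic): for each of the three foliations $f_p$ at $p$, the singular set $S\cup\{p\}$, with the foliation $f_p$ at $p$ and the given foliations at the points of $S$, has no BPS states. -/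

import Mathlib

open scoped Manifold ContDiff Topology

/-- The cotangent line `T*_x X` of a Riemann surface `X` at `x`: complex linear forms on `T_x X`. -/
abbrev Cotangent (X : Type*) [TopologicalSpace X] [ChartedSpace ℂ X] (x : X) : Type :=
  TangentSpace 𝓘(ℂ) x →L[ℂ] ℂ

/-- The covector `dz` at `x` of the local coordinate `z = chartAt ℂ x₀`. -/
noncomputable def coordForm {X : Type*} [TopologicalSpace X] [ChartedSpace ℂ X] (x₀ x : X) :
    Cotangent X x :=
  mfderiv 𝓘(ℂ) 𝓘(ℂ) (chartAt ℂ x₀) x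

/-- An `SL(3)` spectral curve `{(x, ξ)} ⊆ T*X`, given through its fibres. In a local coordinate `z`
it is the zero set `{c dz : c ^ 3 + a(z) c + b(z) = 0}` of a monic cubic polynomial with
holomorphic coefficients and vanishing trace, and every zero of the discriminant is simple:
the curve is smooth and its ramification consists of simple branch points. -/
structure SpectralCurve (X : Type*) [TopologicalSpace X] [ChartedSpace ℂ X] where
  /-- the sheets (at most three covectors) over a point -/
  fiber : ∀ x : X, Set (Cotangent X x)
  local_equation : ∀ x₀ : X, ∃ a b : ℂ → ℂ,
    DifferentiableOn ℂ a (chartAt ℂ x₀).target ∧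
    DifferentiableOn ℂ b (chartAt ℂ x₀).target ∧
    (∀ x ∈ (chartAt ℂ x₀).source, ∀ c : ℂ,
      c • coordForm x₀ x ∈ fiber x ↔
        c ^ 3 + a (chartAt ℂ x₀ x) * c + b (chartAt ℂ x₀ x) = 0) ∧
    (∀ z ∈ (chartAt ℂ x₀).target, 4 * a z ^ 3 + 27 * b z ^ 2 = 0 →
      deriv (fun w => 4 * a w ^ 3 + 27 * b w ^ 2) z ≠ 0)

namespace SpectralCurve

variable {X : Type*} [TopologicalSpace X] [ChartedSpace ℂ X]

/-- The branch points: there are fewer than three distinct sheets over them. -/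
def branch (C : SpectralCurve X) : Set X := {x | (C.fiber x).ncard < 3}

/-- The (interior of the) caustics: points away from the branch points at which the three foliations
`Re (φ_i - φ_j) = 0` have a common tangent direction. -/
def caustic (C : SpectralCurve X) : Set X :=
  {x | x ∉ C.branch ∧ ∃ v : TangentSpace 𝓘(ℂ) x, v ≠ 0 ∧
    ∀ ξ ∈ C.fiber x, ∀ η ∈ C.fiber x, ((ξ - η) v).re = 0}

/-- One of the foliations at `x`: an unordered pair `{φ_i, φ_j}` of distinct sheets. -/
def IsFoliationAt (C : SpectralCurve X) (x : X) (F : Set (Cotangent X x)) : Prop :=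
  ∃ ξ ∈ C.fiber x, ∃ η ∈ C.fiber x, ξ ≠ η ∧ F = {ξ, η}

/-- A compact segment of a foliation line, parametrized by `[0, 1]`. It carries two continuous
sheets `φ_i = fst`, `φ_j = snd` of the spectral curve along the path. Away from branch points its
velocity exists and `φ_i - φ_j` takes a value in `i ℝ_{>0}` on it: the real part vanishes, so the
path follows the foliation `Re (φ_i - φ_j) = 0`, and the order of the pair is the one for which the
imaginary part is positive. Only the two ends may be branch points. Values of the functions outside
`[0, 1]` are irrelevant. -/
structure Leaf (C : SpectralCurve X) where
  path : ℝ → X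
  continuousOn_path : ContinuousOn path (Set.Icc 0 1)
  not_branch : ∀ t ∈ Set.Ioo (0 : ℝ) 1, path t ∉ C.branch
  fst : ∀ t : ℝ, Cotangent X (path t)
  snd : ∀ t : ℝ, Cotangent X (path t)
  fst_mem : ∀ t ∈ Set.Icc (0 : ℝ) 1, fst t ∈ C.fiber (path t)
  snd_mem : ∀ t ∈ Set.Icc (0 : ℝ) 1, snd t ∈ C.fiber (path t)
  /-- the two sheets vary continuously: so do their coefficients in a local coordinate -/
  continuous_fst : ∀ t₀ ∈ Set.Icc (0 : ℝ) 1, ∃ c : ℝ → ℂ,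
    ContinuousWithinAt c (Set.Icc 0 1) t₀ ∧
    ∀ᶠ t in 𝓝[Set.Icc 0 1] t₀, fst t = c t • coordForm (path t₀) (path t)
  continuous_snd : ∀ t₀ ∈ Set.Icc (0 : ℝ) 1, ∃ c : ℝ → ℂ,
    ContinuousWithinAt c (Set.Icc 0 1) t₀ ∧
    ∀ᶠ t in 𝓝[Set.Icc 0 1] t₀, snd t = c t • coordForm (path t₀) (path t)
  /-- the velocity vector; `T_x X` is identified with `ℂ` by the preferred chart at `x` -/
  vel : ∀ t : ℝ, TangentSpace 𝓘(ℂ) (path t)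
  hasDeriv : ∀ t ∈ Set.Icc (0 : ℝ) 1, path t ∉ C.branch →
    HasDerivWithinAt (fun u => chartAt ℂ (path t) (path u)) (vel t) (Set.Icc 0 1) t
  re_eq_zero : ∀ t ∈ Set.Icc (0 : ℝ) 1, path t ∉ C.branch → ((fst t - snd t) (vel t)).re = 0
  im_pos : ∀ t ∈ Set.Icc (0 : ℝ) 1, path t ∉ C.branch → 0 < ((fst t - snd t) (vel t)).im

/-- `l.Departs b x α β w`: the half-edge of `l` at its start (`b = false`) or its finish (`b = true`)
sits at the point `x`, and seen as going out of `x` it has the ordered pair of sheets `(α, β)` and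
the velocity `w`. Reversing the direction of a segment exchanges the two sheets. -/
inductive Leaf.Departs {C : SpectralCurve X} (l : C.Leaf) :
    Bool → (x : X) → Cotangent X x → Cotangent X x → TangentSpace 𝓘(ℂ) x → Prop
  | start : l.Departs false (l.path 0) (l.fst 0) (l.snd 0) (l.vel 0)
  | finish : l.Departs true (l.path 1) (l.snd 1) (l.fst 1) (-l.vel 1)

/-- The differential at a point of the flat coordinates `(Re φ_1, Re φ_2, Re φ_3)`, with values in
the standard apartment `{x_1 + x_2 + x_3 = 0} ⊆ ℝ³`. -/
noncomputable def flat {x : X} (s : Fin 3 → Cotangent X x) (v : TangentSpace 𝓘(ℂ) x) :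
    EuclideanSpace ℝ (Fin 3) :=
  WithLp.toLp 2 (fun i => (s i v).re)

/-- Three tangent vectors at `x` which pairwise make an angle of 120 degrees in the flat structure.
(At a caustic point the flat coordinates have rank at most one and this never holds; the
three directions are then automatically those of the three different foliations if each of them is
the direction of a foliation.) -/
def Meet120 (C : SpectralCurve X) (x : X) (w : Fin 3 → TangentSpace 𝓘(ℂ) x) : Prop :=
  ∃ s : Fin 3 → Cotangent X x, Function.Injective s ∧ Set.range s = C.fiber x ∧
    ∀ i j, i ≠ j → InnerProductGeometry.angle (flat s (w i)) (flat s (w j)) = 2 * Real.pi / 3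

/-- A finite set `S` of singularities containing all branch points, with a choice `f_p` of one of the
three foliations at each point `p` of `S` which is not a branch point (at a branch point the
foliation is the one of the two sheets that come together). -/
structure SingularSet (C : SpectralCurve X) where
  points : Set X
  finite_points : points.Finite
  branch_subset : C.branch ⊆ points
  foliation : ∀ x : X, Set (Cotangent X x)
  isFoliation : ∀ x ∈ points, x ∉ C.branch → C.IsFoliationAt x (foliation x)

open Classical in
/-- The singular set `S ∪ {p}`, with the foliation `F` at the new point `p`. -/
noncomputable def SingularSet.adjoin {C : SpectralCurve X} (S : C.SingularSet) (p : X)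
    (F : Set (Cotangent X p)) (hF : C.IsFoliationAt p F) : C.SingularSet where
  points := insert p S.points
  finite_points := S.finite_points.insert p
  branch_subset := S.branch_subset.trans (Set.subset_insert p S.points)
  foliation := Function.update S.foliation p F
  isFoliation := by
    intro x hx hb
    by_cases h : x = p
    · subst h
      simpa using hF
    · rw [Function.update_of_ne h]
      exact S.isFoliation x (hx.resolve_left h) hb

/-- A BPS state of the spectral network of `S`: a compact spectral network graph. The graph is finite
and nonempty, loops, multiple edges and non-injective maps to `X` are allowed. Its edges are mapped
to segments of foliation lines. Every vertex is

* an endpoint (one half-edge), sent to a point `p` of `S` along the foliation chosen there, or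
* a collision (three half-edges), where foliation lines meet at 120 degrees, or
* a mere subdivision point (two half-edges), through which a foliation line passes straight on.

The latter are no vertices of the trivalent graph; they are there so that its edges may be
subdivided, and a component may be a circle, that is, a closed foliation line. -/
structure SingularSet.BPSState {C : SpectralCurve X} (S : C.SingularSet) where
  Edge : Type
  Vertex : Type
  finite_edge : Finite Edge
  nonempty_edge : Nonempty Edge
  finite_vertex : Finite Vertex
  leaf : Edge → C.Leaf
  /-- the vertex at which a half-edge (start: `false`, finish: `true`) is attached -/
  vertex : Edge × Bool → Vertex
  position : Vertex → X
  local_form : ∀ v : Vertex,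
    -- endpoint
    (∃ h : Edge × Bool, vertex ⁻¹' {v} = {h} ∧ position v ∈ S.points ∧
      ∃ α β w, (leaf h.1).Departs h.2 (position v) α β w ∧
        (position v ∈ C.branch → α = β) ∧
        (position v ∉ C.branch → S.foliation (position v) = {α, β})) ∨
    -- subdivision point
    (∃ h k : Edge × Bool, h ≠ k ∧ vertex ⁻¹' {v} = {h, k} ∧ position v ∉ C.branch ∧
      ∃ α β w w', (leaf h.1).Departs h.2 (position v) α β w ∧
        (leaf k.1).Departs k.2 (position v) β α w') ∨
    -- collision
    (∃ h : Fin 3 → Edge × Bool, Function.Injective h ∧ vertex ⁻¹' {v} = Set.range h ∧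
      position v ∉ C.branch ∧
      ∃ (α β : Fin 3 → Cotangent X (position v)) (w : Fin 3 → TangentSpace 𝓘(ℂ) (position v)),
        (∀ i, (leaf (h i).1).Departs (h i).2 (position v) (α i) (β i) (w i)) ∧
        C.Meet120 (position v) w)

/-- The spectral network of `S` has a BPS state. -/
def SingularSet.HasBPSState {C : SpectralCurve X} (S : C.SingularSet) : Prop :=
  Nonempty S.BPSState

/-- The caustic runs along a foliation line at `p`: it contains an open arc of a foliation line
through `p`. -/
def CausticIsLeafAt (C : SpectralCurve X) (p : X) : Prop :=
  ∃ (l : C.Leaf) (t : ℝ), t ∈ Set.Ioo (0 : ℝ) 1 ∧ l.path t = p ∧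
    ∀ u ∈ Set.Ioo (0 : ℝ) 1, l.path u ∈ C.caustic

end SpectralCurve

/-! The argument is a conservation law. Let `λ = c dz` be the tautological form on the spectral
curve. The real parts of its local primitives form a multivalued function whose ambiguities generate
a countable group. Dividing `ℝ` by a suitable countable rational subspace `P` makes it a function
`pot` on the sheets with values in `ℝ ⧸ P`. Enlarging `P` also makes the values of `pot` on all
sheets over each point of the finite set `S` agree (`exists_potential`).

To an oriented foliation line with sheets `(α, β)` assign the flux `pot α - pot β`. It is constant
along the line because `Re (α - β)` vanishes on the velocity (`Leaf.potential_sub_eq`), and it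
changes sign with the orientation. The outgoing fluxes at a subdivision point cancel. At a
collision, the 120 degree condition forces the three ordered pairs to form a cycle, so the sum
vanishes there too (`sum_sub_eq_zero_of_angle`). At an endpoint in `S` the flux vanishes by the
choice of `P`.

Now take a BPS state for `S ∪ {p}`, with `m` endpoints at `p` leaving with the pair `(α, β)` and `n`
with `(β, α)`. Summing over all half-edges gives `(m - n) • (pot α - pot β) = 0`. If `m = n`, the
endpoints at `p` can be joined in opposite pairs, each becoming a point through which a line passes
straight on, and a BPS state for `S` results. Hence `m ≠ n`, and the flux at `p` vanishes because `ℝ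
⧸ P` is a rational vector space (`flux_eq_zero_of_hasBPSState`).

So `p` satisfies `Re (∫ α - ∫ β) = r` for one of countably many `r ∈ P`. Locally such a level set is
a foliation line, a real analytic arc, on which the caustic is cut out by a real analytic equation.
Either the equation holds identically near `p` and the caustic runs along the line, or `p` is
isolated in the intersection (`exists_nhds_caustic_eq`). Second countability then leaves only
countably many such `p`. -/

/-! ### Primitives of `c dz` on smooth plane curves -/

/-- The implicit function theorem for a holomorphic function of two variables. -/
lemma exists_analyticAt_graph {f : ℂ × ℂ → ℂ} {u : ℂ × ℂ} (hf : ContDiffAt ℂ ω f u)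
    (h0 : f u = 0) (hd : fderiv ℂ f u (0, 1) ≠ 0) :
    ∃ γ : ℂ → ℂ, AnalyticAt ℂ γ u.1 ∧ γ u.1 = u.2 ∧ (∀ᶠ z in 𝓝 u.1, f (z, γ z) = 0) ∧
      ∀ᶠ q in 𝓝 u, f q = 0 → q.2 = γ q.1 := by
  have hinv : (fderiv ℂ f u ∘L .inr ℂ ℂ ℂ).IsInvertible := by
    refine ⟨ContinuousLinearEquiv.unitsEquivAut ℂ (Units.mk0 _ hd), ?_⟩
    ext
    simp
  refine ⟨hf.implicitFunction (by simp) hinv, ?_, hf.implicitFunction_apply_self _ _, ?_, ?_⟩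
  · exact (hf.contDiffAt_implicitFunction (by simp) hinv).analyticAt
  · filter_upwards [hf.eventually_apply_implicitFunction (by simp) hinv] with z hz
    rw [hz, h0]
  · filter_upwards [hf.eventually_apply_eq_iff_implicitFunction (by simp) hinv] with q hq hq0
    exact (hq.1 (by rw [hq0, h0])).symm

lemma AnalyticAt.exists_primitive {γ : ℂ → ℂ} {z₀ : ℂ} (h : AnalyticAt ℂ γ z₀) :
    ∃ r > 0, ∃ g : ℂ → ℂ, ∀ z ∈ Metric.ball z₀ r, HasDerivAt g (γ z) z := by
  obtain ⟨r, hr, hb⟩ := Metric.eventually_nhds_iff_ball.1 h.eventually_analyticAt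
  have hd : DifferentiableOn ℂ γ (Metric.ball z₀ r) :=
    fun z hz => (hb z hz).differentiableAt.differentiableWithinAt
  obtain ⟨g, hg⟩ := hd.isExactOn_ball
  exact ⟨r, hr, g, hg⟩

/-- `G` restricts on `V` to a primitive of `c dz` along the curve `f (z, c) = 0`. -/
structure IsLocalPrimitive (f : ℂ × ℂ → ℂ) (V : Set (ℂ × ℂ)) (G : ℂ × ℂ → ℂ) : Prop where
  continuousOn : ContinuousOn G V
  exists_hasDerivAt : ∀ q ∈ V, f q = 0 → fderiv ℂ f q (0, 1) ≠ 0 →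
    ∃ g : ℂ → ℂ, HasDerivAt g q.2 q.1 ∧ ∀ᶠ p in 𝓝 q, f p = 0 → G p = g p.1

/-- Where `∂f/∂c ≠ 0` the curve is a graph `c = γ(z)` and a primitive of `γ` serves. Otherwise, as
at a branch point, it is a graph `z = ζ(c)` and the form is `c ζ'(c) dc`, with a primitive in the
variable `c`. The second case makes the primitive continuous through branch points, where foliation
lines may end. -/
lemma exists_isLocalPrimitive {f : ℂ × ℂ → ℂ} {Ω : Set (ℂ × ℂ)} (hΩ : IsOpen Ω)
    (hf : ∀ q ∈ Ω, ContDiffAt ℂ ω f q) {u : ℂ × ℂ} (hu : u ∈ Ω) (h0 : f u = 0)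
    (hd : fderiv ℂ f u (0, 1) ≠ 0 ∨ fderiv ℂ f u (1, 0) ≠ 0) :
    ∃ (V : Set (ℂ × ℂ)) (G : ℂ × ℂ → ℂ), IsOpen V ∧ u ∈ V ∧ V ⊆ Ω ∧ IsLocalPrimitive f V G := by
  rcases hd with hd | hd
  · obtain ⟨γ, hγ, hγu, -, hγf⟩ := exists_analyticAt_graph (hf u hu) h0 hd
    obtain ⟨r, hr, g, hg⟩ := hγ.exists_primitive
    have hball : ∀ᶠ q : ℂ × ℂ in 𝓝 u, q.1 ∈ Metric.ball u.1 r :=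
      continuous_fst.continuousAt.eventually (Metric.ball_mem_nhds u.1 hr)
    obtain ⟨V, hV, hVo, huV⟩ :=
      eventually_nhds_iff.1 ((hγf.and hball).and (hΩ.eventually_mem hu))
    refine ⟨V, fun q => g q.1, hVo, huV, fun q hq => (hV q hq).2, ?_, ?_⟩
    · intro q hq
      exact ((hg q.1 (hV q hq).1.2).continuousAt.comp continuous_fst.continuousAt).continuousWithinAt
    · intro q hq hq0 _
      refine ⟨g, ?_, Filter.Eventually.of_forall fun p _ => rfl⟩
      rw [(hV q hq).1.1 hq0]
      exact hg q.1 (hV q hq).1.2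
  · have hswap : ContDiffAt ℂ ω (fun q : ℂ × ℂ => f q.swap) u.swap :=
      ContDiffAt.comp (u.swap) (f := Prod.swap) (g := f) (by simpa using hf u hu)
        (contDiff_snd.prodMk contDiff_fst).contDiffAt
    have hds : fderiv ℂ (fun q : ℂ × ℂ => f q.swap) u.swap (0, 1) ≠ 0 := by
      have h1 : HasFDerivAt (Prod.swap : ℂ × ℂ → ℂ × ℂ)
          ((ContinuousLinearMap.snd ℂ ℂ ℂ).prod (ContinuousLinearMap.fst ℂ ℂ ℂ)) u.swap :=
        ((ContinuousLinearMap.snd ℂ ℂ ℂ).prod (ContinuousLinearMap.fst ℂ ℂ ℂ)).hasFDerivAt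
      have h2 : HasFDerivAt f (fderiv ℂ f u) (Prod.swap u.swap) := by
        rw [Prod.swap_swap]
        exact ((hf u hu).differentiableAt (by simp)).hasFDerivAt
      have h3 := HasFDerivAt.comp u.swap h2 h1
      have h4 := h3.fderiv
      rw [show (fun q : ℂ × ℂ => f q.swap) = f ∘ Prod.swap from rfl, h4]
      simpa using hd
    obtain ⟨ζ, hζ, hζu, -, hζf⟩ := exists_analyticAt_graph hswap (by simpa using h0) hds
    obtain ⟨r, hr, G, hG⟩ := (analyticAt_id.mul hζ.deriv).exists_primitive
    obtain ⟨r', hr', hζd⟩ := Metric.eventually_nhds_iff_ball.1 hζ.eventually_analyticAt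
    have hball : ∀ᶠ q : ℂ × ℂ in 𝓝 u, q.2 ∈ Metric.ball u.2 r :=
      continuous_snd.continuousAt.eventually (Metric.ball_mem_nhds u.2 hr)
    have hball' : ∀ᶠ q : ℂ × ℂ in 𝓝 u, q.2 ∈ Metric.ball u.2 r' :=
      continuous_snd.continuousAt.eventually (Metric.ball_mem_nhds u.2 hr')
    have hgr : ∀ᶠ q : ℂ × ℂ in 𝓝 u, f q = 0 → q.1 = ζ q.2 := by
      have := (continuous_swap.tendsto u).eventually hζf
      simpa using this
    obtain ⟨V, hV, hVo, huV⟩ :=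
      eventually_nhds_iff.1 (((hgr.and hball).and hball').and (hΩ.eventually_mem hu))
    refine ⟨V, fun q => G q.2, hVo, huV, fun q hq => (hV q hq).2, ?_, ?_⟩
    · intro q hq
      exact ((hG q.2 (hV q hq).1.1.2).continuousAt.comp
        continuous_snd.continuousAt).continuousWithinAt
    · intro q hq hq0 hqd
      obtain ⟨γ, hγ, hγq, hγ0, hγf⟩ := exists_analyticAt_graph (hf q (hV q hq).2) hq0 hqd
      refine ⟨fun z => G (γ z), ?_, ?_⟩
      · have hGq := hG q.2 (hV q hq).1.1.2
        have hζq := (hζd q.2 (hV q hq).1.2).differentiableAt.hasDerivAt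
        have hγ' := hγ.differentiableAt.hasDerivAt
        rw [← hγq] at hGq hζq
        have hcomp := hζq.comp q.1 hγ'
        -- At an unramified point of the patch both descriptions hold, `ζ` and `γ` are inverse to
        -- each other, and `c ζ'(c) dc` turns back into `γ dz`.
        have hid : (ζ ∘ γ) =ᶠ[𝓝 q.1] id := by
          have hcont : Filter.Tendsto (fun z => (z, γ z)) (𝓝 q.1) (𝓝 q) := by
            have : ContinuousAt (fun z => (z, γ z)) q.1 := continuousAt_id.prodMk hγ.continuousAt
            simpa [ContinuousAt, hγq] using this
          filter_upwards [hcont.eventually (hVo.eventually_mem hq), hγ0] with z hz hz0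
          exact ((hV _ hz).1.1.1 hz0).symm
        have h1 := (hcomp.congr_of_eventuallyEq hid.symm).unique (hasDerivAt_id q.1)
        have h2 : γ q.1 * deriv ζ (γ q.1) * deriv γ q.1 = q.2 := by
          rw [mul_assoc, h1, mul_one, hγq]
        have h3 := hGq.comp q.1 hγ'
        rw [← h2]
        exact h3
      · filter_upwards [hγf] with p hp hp0
        show G p.2 = G (γ p.1)
        rw [hp hp0]

/-! ### The cubic equation -/

/-- The cubic polynomial `c ^ 3 + a(z) c + b(z)`. -/
def cubicEq (a b : ℂ → ℂ) (q : ℂ × ℂ) : ℂ := q.2 ^ 3 + a q.1 * q.2 + b q.1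

section cubic

variable {a b : ℂ → ℂ} {D : Set ℂ}

lemma contDiffAt_cubicEq (hD : IsOpen D) (ha : DifferentiableOn ℂ a D)
    (hb : DifferentiableOn ℂ b D) {q : ℂ × ℂ} (hq : q.1 ∈ D) : ContDiffAt ℂ ω (cubicEq a b) q := by
  have ha' : ContDiffAt ℂ ω a q.1 := (ha.analyticAt (hD.mem_nhds hq)).contDiffAt
  have hb' : ContDiffAt ℂ ω b q.1 := (hb.analyticAt (hD.mem_nhds hq)).contDiffAt
  have ha'' : ContDiffAt ℂ ω (fun p : ℂ × ℂ => a p.1) q := ha'.comp q contDiffAt_fst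
  have hb'' : ContDiffAt ℂ ω (fun p : ℂ × ℂ => b p.1) q := hb'.comp q contDiffAt_fst
  unfold cubicEq
  fun_prop

lemma fderiv_cubicEq (hD : IsOpen D) (ha : DifferentiableOn ℂ a D)
    (hb : DifferentiableOn ℂ b D) {q : ℂ × ℂ} (hq : q.1 ∈ D) (v : ℂ × ℂ) :
    fderiv ℂ (cubicEq a b) q v =
      (3 * q.2 ^ 2 + a q.1) * v.2 + (deriv a q.1 * q.2 + deriv b q.1) * v.1 := by
  have ha' := (ha.differentiableAt (hD.mem_nhds hq)).hasDerivAt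
  have hb' := (hb.differentiableAt (hD.mem_nhds hq)).hasDerivAt
  have h1 : HasFDerivAt (fun p : ℂ × ℂ => p.1) (ContinuousLinearMap.fst ℂ ℂ ℂ) q := hasFDerivAt_fst
  have h2 : HasFDerivAt (fun p : ℂ × ℂ => p.2) (ContinuousLinearMap.snd ℂ ℂ ℂ) q := hasFDerivAt_snd
  have h := ((h2.pow 3).add ((ha'.comp_hasFDerivAt q h1).mul h2)).add (hb'.comp_hasFDerivAt q h1)
  have h' : HasFDerivAt (cubicEq a b) _ q := h
  rw [h'.fderiv]
  simp
  ring

/-- A plane cubic curve whose discriminant has simple zeros is smooth. -/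
lemma fderiv_cubicEq_ne_zero (hD : IsOpen D) (ha : DifferentiableOn ℂ a D)
    (hb : DifferentiableOn ℂ b D)
    (hs : ∀ z ∈ D, 4 * a z ^ 3 + 27 * b z ^ 2 = 0 →
      deriv (fun w => 4 * a w ^ 3 + 27 * b w ^ 2) z ≠ 0)
    {q : ℂ × ℂ} (hq : q.1 ∈ D) (h0 : cubicEq a b q = 0) :
    fderiv ℂ (cubicEq a b) q (0, 1) ≠ 0 ∨ fderiv ℂ (cubicEq a b) q (1, 0) ≠ 0 := by
  rw [fderiv_cubicEq hD ha hb hq, fderiv_cubicEq hD ha hb hq]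
  by_contra! h
  obtain ⟨h1, h2⟩ := h
  simp only [mul_one, mul_zero, add_zero, zero_add] at h1 h2
  -- A singular point lies over a double root `c`, so `a = -3c²` and `b = 2c³`. There the derivative
  -- of the discriminant is `108 c³ (a' c + b')`, and the last factor is the vanishing derivative in
  -- `z`.
  have ha0 : a q.1 = -3 * q.2 ^ 2 := by linear_combination h1
  have hb0 : b q.1 = 2 * q.2 ^ 3 := by
    unfold cubicEq at h0
    linear_combination h0 - q.2 * ha0
  refine hs q.1 hq (by rw [ha0, hb0]; ring) ?_
  have ha' := (ha.differentiableAt (hD.mem_nhds hq)).hasDerivAt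
  have hb' := (hb.differentiableAt (hD.mem_nhds hq)).hasDerivAt
  have h := ((ha'.pow 3).const_mul 4).add ((hb'.pow 2).const_mul 27)
  have h' : HasDerivAt (fun w => 4 * a w ^ 3 + 27 * b w ^ 2) _ q.1 := h
  rw [h'.deriv, ha0, hb0]
  simp
  linear_combination 108 * q.2 ^ 3 * h2

/-- Two distinct zeros of a cubic polynomial of vanishing trace determine it. -/
lemma cubic_coeff_eq {A B c d : ℂ} (hc : c ^ 3 + A * c + B = 0) (hd : d ^ 3 + A * d + B = 0)
    (hcd : c ≠ d) : A = -(c ^ 2 + c * d + d ^ 2) ∧ B = c * d * (c + d) := by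
  have hA : A = -(c ^ 2 + c * d + d ^ 2) := by
    have : (c - d) * (A + (c ^ 2 + c * d + d ^ 2)) = 0 := by linear_combination hc - hd
    rcases mul_eq_zero.1 this with h | h
    · exact absurd (sub_eq_zero.1 h) hcd
    · linear_combination h
  refine ⟨hA, ?_⟩
  rw [hA] at hc
  linear_combination hc

lemma cubic_sum_eq_zero {A B c d e : ℂ} (hc : c ^ 3 + A * c + B = 0) (hd : d ^ 3 + A * d + B = 0)
    (he : e ^ 3 + A * e + B = 0) (hcd : c ≠ d) (hce : c ≠ e) (hde : d ≠ e) : c + d + e = 0 := by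
  have h1 := (cubic_coeff_eq hc hd hcd).1
  have h2 := (cubic_coeff_eq hc he hce).1
  have : (d - e) * (c + d + e) = 0 := by linear_combination h1 - h2
  exact (mul_eq_zero.1 this).resolve_left (sub_ne_zero.2 hde)

/-- A cubic polynomial with three distinct zeros is unramified at each of them. -/
lemma cubic_unramified {A B c d e f : ℂ} (hc : c ^ 3 + A * c + B = 0) (hd : d ^ 3 + A * d + B = 0)
    (he : e ^ 3 + A * e + B = 0) (hcd : c ≠ d) (hce : c ≠ e) (hde : d ≠ e)
    (hf : f ^ 3 + A * f + B = 0) : 3 * f ^ 2 + A ≠ 0 := by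
  have hs := cubic_sum_eq_zero hc hd he hcd hce hde
  obtain ⟨hA, hB⟩ := cubic_coeff_eq hc hd hcd
  have he' : e = -(c + d) := by linear_combination hs
  intro h
  have h1 : (f - c) * (f - d) * (f - e) = 0 := by
    rw [he']; rw [hA, hB] at hf; linear_combination hf
  rw [hA] at h
  subst he'
  rcases mul_eq_zero.1 h1 with h1 | h1
  · rcases mul_eq_zero.1 h1 with h1 | h1
    · have : f = c := by linear_combination h1
      subst this
      have : (f - d) * (f - -(f + d)) = 0 := by linear_combination h
      rcases mul_eq_zero.1 this with h | h
      · exact hcd (sub_eq_zero.1 h)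
      · exact hce (sub_eq_zero.1 h)
    · have : f = d := by linear_combination h1
      subst this
      have : (f - c) * (f - -(c + f)) = 0 := by linear_combination h
      rcases mul_eq_zero.1 this with h | h
      · exact hcd (sub_eq_zero.1 h).symm
      · exact hde (sub_eq_zero.1 h)
  · have : f = -(c + d) := by linear_combination h1
    subst this
    have : (-(c + d) - c) * (-(c + d) - d) = 0 := by linear_combination h
    rcases mul_eq_zero.1 this with h | h
    · exact hce (sub_eq_zero.1 h).symm
    · exact hde (sub_eq_zero.1 h).symm

end cubic

/-! ### A countability criterion -/

/-- A locally constant function on a subset of a second countable space has countable range. -/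
lemma countable_image_of_locally_constant {Y E Z : Type*} [TopologicalSpace E]
    [SecondCountableTopology E] (T : Set Y) (e : Y → E) (d : Y → Z)
    (h : ∀ y ∈ T, ∃ W ∈ 𝓝 (e y), ∀ y' ∈ T, e y' ∈ W → d y' = d y) : (d '' T).Countable := by
  rcases T.eq_empty_or_nonempty with rfl | hT
  · simp
  have : Nonempty Y := hT.nonempty
  choose! W hW hd using h
  have hsub : ∀ x ∈ e '' T, ∃ y ∈ T, e y = x := fun x hx => hx
  choose! r hr hre using hsub
  -- Lindelöf for `e '' T`: countably many of the neighbourhoods suffice, and `d` takes one value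
  -- over each. The set `Y` itself needs no topology.
  obtain ⟨t, ht, htc, hcov⟩ := TopologicalSpace.countable_cover_nhdsWithin
    (f := fun x => W (r x)) (s := e '' T)
    (fun x hx => mem_nhdsWithin_of_mem_nhds (by
      have := hW (r x) (hr x hx)
      rwa [hre x hx] at this))
  refine (htc.image (fun x => d (r x))).mono ?_
  rintro _ ⟨y, hy, rfl⟩
  obtain ⟨x, hx, hyx⟩ := Set.mem_iUnion₂.1 (hcov ⟨y, hy, rfl⟩)
  exact ⟨x, hx, (hd (r x) (hr x (ht hx)) y hy hyx).symm⟩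

/-! ### Changes of charts on a Riemann surface -/

section charts

variable {X : Type*} [TopologicalSpace X] [ChartedSpace ℂ X]

/-- The transition map from the coordinate at `x₁` to the coordinate at `x₀`. -/
noncomputable def chartTransition (x₁ x₀ : X) : ℂ → ℂ :=
  fun z => chartAt ℂ x₀ ((chartAt ℂ x₁).symm z)

/-- A covector as a linear form on `ℂ`, through the preferred coordinate. -/
def covectorForm {x : X} (ξ : Cotangent X x) : ℂ →L[ℂ] ℂ := ξ

/-- The coefficient of a covector with respect to the coordinate at `x₀`. -/
noncomputable def covectorCoeff (x₀ x : X) (ξ : Cotangent X x) : ℂ :=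
  covectorForm ξ 1 / deriv (chartTransition x x₀) (chartAt ℂ x x)

/-- The coordinates of a point of the cotangent bundle, in the chart at `x₀`. -/
noncomputable def cotangentCoord (x₀ x : X) (ξ : Cotangent X x) : ℂ × ℂ :=
  (chartAt ℂ x₀ x, covectorCoeff x₀ x ξ)

lemma eventually_chart_symm_mem {x₁ x : X} (h₁ : x ∈ (chartAt ℂ x₁).source) {U : Set X}
    (hU : U ∈ 𝓝 x) : ∀ᶠ z in 𝓝 (chartAt ℂ x₁ x), (chartAt ℂ x₁).symm z ∈ U := by
  have h := (chartAt ℂ x₁).continuousAt_symm ((chartAt ℂ x₁).map_source h₁)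
  rw [ContinuousAt, (chartAt ℂ x₁).left_inv h₁] at h
  exact h hU

lemma chartTransition_apply {x₁ x₀ x : X} (h₁ : x ∈ (chartAt ℂ x₁).source) :
    chartTransition x₁ x₀ (chartAt ℂ x₁ x) = chartAt ℂ x₀ x := by
  simp [chartTransition, (chartAt ℂ x₁).left_inv h₁]

lemma deriv_chartTransition_self {x₁ x : X} (h₁ : x ∈ (chartAt ℂ x₁).source) :
    deriv (chartTransition x₁ x₁) (chartAt ℂ x₁ x) = 1 := by
  have : chartTransition x₁ x₁ =ᶠ[𝓝 (chartAt ℂ x₁ x)] id := by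
    filter_upwards [(chartAt ℂ x₁).open_target.mem_nhds ((chartAt ℂ x₁).map_source h₁)] with z hz
    exact (chartAt ℂ x₁).right_inv hz
  rw [this.deriv_eq, deriv_id]

variable [IsManifold 𝓘(ℂ) ω X]

lemma differentiableAt_chartTransition {x₁ x₀ x : X} (h₁ : x ∈ (chartAt ℂ x₁).source)
    (h₀ : x ∈ (chartAt ℂ x₀).source) :
    DifferentiableAt ℂ (chartTransition x₁ x₀) (chartAt ℂ x₁ x) := by
  have := IsManifold.of_le (I := 𝓘(ℂ)) (M := X) (m := 1) (n := ω) (by simp)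
  have hs : MDifferentiableAt 𝓘(ℂ) 𝓘(ℂ) (chartAt ℂ x₁).symm (chartAt ℂ x₁ x) :=
    mdifferentiableAt_atlas_symm (chart_mem_atlas ℂ x₁) ((chartAt ℂ x₁).map_source h₁)
  have ht : MDifferentiableAt 𝓘(ℂ) 𝓘(ℂ) (chartAt ℂ x₀)
      ((chartAt ℂ x₁).symm (chartAt ℂ x₁ x)) := by
    rw [(chartAt ℂ x₁).left_inv h₁]
    exact mdifferentiableAt_atlas (chart_mem_atlas ℂ x₀) h₀
  exact mdifferentiableAt_iff_differentiableAt.1 (ht.comp _ hs)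

lemma analyticAt_chartTransition {x₁ x₀ x : X} (h₁ : x ∈ (chartAt ℂ x₁).source)
    (h₀ : x ∈ (chartAt ℂ x₀).source) :
    AnalyticAt ℂ (chartTransition x₁ x₀) (chartAt ℂ x₁ x) := by
  rw [Complex.analyticAt_iff_eventually_differentiableAt]
  filter_upwards [eventually_chart_symm_mem h₁ ((chartAt ℂ x₀).open_source.mem_nhds h₀),
    (chartAt ℂ x₁).open_target.mem_nhds ((chartAt ℂ x₁).map_source h₁)] with z hz hz'
  have := differentiableAt_chartTransition ((chartAt ℂ x₁).map_target hz') hz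
  rwa [(chartAt ℂ x₁).right_inv hz'] at this

lemma deriv_chartTransition_comp {x₁ x₂ x₀ x : X} (h₁ : x ∈ (chartAt ℂ x₁).source)
    (h₂ : x ∈ (chartAt ℂ x₂).source) (h₀ : x ∈ (chartAt ℂ x₀).source) :
    deriv (chartTransition x₁ x₀) (chartAt ℂ x₁ x) =
      deriv (chartTransition x₂ x₀) (chartAt ℂ x₂ x) *
        deriv (chartTransition x₁ x₂) (chartAt ℂ x₁ x) := by
  have h12 := (differentiableAt_chartTransition h₁ h₂).hasDerivAt
  have h20 := (differentiableAt_chartTransition h₂ h₀).hasDerivAt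
  have h20' := h20
  rw [← chartTransition_apply (x₀ := x₂) h₁] at h20
  have h := h20.comp _ h12
  rw [chartTransition_apply h₁] at h
  refine (h.congr_of_eventuallyEq ?_).deriv
  filter_upwards [eventually_chart_symm_mem h₁ ((chartAt ℂ x₂).open_source.mem_nhds h₂)] with z hz
  simp [chartTransition, (chartAt ℂ x₂).left_inv hz]

lemma deriv_chartTransition_mul {x₁ x₀ x : X} (h₁ : x ∈ (chartAt ℂ x₁).source)
    (h₀ : x ∈ (chartAt ℂ x₀).source) :
    deriv (chartTransition x₁ x₀) (chartAt ℂ x₁ x) *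
      deriv (chartTransition x₀ x₁) (chartAt ℂ x₀ x) = 1 := by
  rw [← deriv_chartTransition_comp h₀ h₁ h₀, deriv_chartTransition_self h₀]

lemma deriv_chartTransition_ne_zero {x₁ x₀ x : X} (h₁ : x ∈ (chartAt ℂ x₁).source)
    (h₀ : x ∈ (chartAt ℂ x₀).source) :
    deriv (chartTransition x₁ x₀) (chartAt ℂ x₁ x) ≠ 0 :=
  left_ne_zero_of_mul_eq_one (deriv_chartTransition_mul h₁ h₀)

lemma covectorForm_smul_coordForm {x₀ x : X} (h₀ : x ∈ (chartAt ℂ x₀).source) (c v : ℂ) :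
    covectorForm (c • coordForm x₀ x) v =
      c * (deriv (chartTransition x x₀) (chartAt ℂ x x) * v) := by
  have := IsManifold.of_le (I := 𝓘(ℂ)) (M := X) (m := 1) (n := ω) (by simp)
  have hm : MDifferentiableAt 𝓘(ℂ) 𝓘(ℂ) (chartAt ℂ x₀) x :=
    mdifferentiableAt_atlas (chart_mem_atlas ℂ x₀) h₀
  have h1 : covectorForm (coordForm x₀ x) =
      fderiv ℂ (chartTransition x x₀) (chartAt ℂ x x) := by
    simp only [covectorForm, coordForm, mfderiv, hm]
    simp [writtenInExtChartAt, extChartAt, fderivWithin_univ]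
    rfl
  have h2 := (differentiableAt_chartTransition (mem_chart_source ℂ x) h₀).hasDerivAt.hasFDerivAt.fderiv
  change c * covectorForm (coordForm x₀ x) v = _
  rw [h1, h2]
  simp [mul_comm]

lemma covectorForm_apply {x₀ x : X} (h₀ : x ∈ (chartAt ℂ x₀).source) (ξ : Cotangent X x) (v : ℂ) :
    covectorForm ξ v =
      covectorCoeff x₀ x ξ * (deriv (chartTransition x x₀) (chartAt ℂ x x) * v) := by
  have hv : covectorForm ξ v = v * covectorForm ξ 1 := by
    simpa using (covectorForm ξ).map_smul v 1
  have hne := deriv_chartTransition_ne_zero (mem_chart_source ℂ x) h₀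
  rw [hv, covectorCoeff]
  field_simp

lemma covectorCoeff_smul_coordForm {x₀ x : X} (h₀ : x ∈ (chartAt ℂ x₀).source)
    (ξ : Cotangent X x) : covectorCoeff x₀ x ξ • coordForm x₀ x = ξ := by
  have : covectorForm (covectorCoeff x₀ x ξ • coordForm x₀ x) = covectorForm ξ := by
    refine ContinuousLinearMap.ext fun v => ?_
    rw [covectorForm_apply h₀ ξ, covectorForm_smul_coordForm h₀]
  exact this

lemma covectorCoeff_smul {x₀ x : X} (h₀ : x ∈ (chartAt ℂ x₀).source) (c : ℂ) :
    covectorCoeff x₀ x (c • coordForm x₀ x) = c := by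
  have hne := deriv_chartTransition_ne_zero (mem_chart_source ℂ x) h₀
  rw [covectorCoeff, covectorForm_smul_coordForm h₀]
  field_simp

lemma covectorCoeff_injective {x₀ x : X} (h₀ : x ∈ (chartAt ℂ x₀).source) :
    Function.Injective (covectorCoeff x₀ x) := fun ξ η h => by
  rw [← covectorCoeff_smul_coordForm h₀ ξ, ← covectorCoeff_smul_coordForm h₀ η, h]

lemma covectorCoeff_change {x₁ x₀ x : X} (h₁ : x ∈ (chartAt ℂ x₁).source)
    (h₀ : x ∈ (chartAt ℂ x₀).source) (ξ : Cotangent X x) :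
    covectorCoeff x₀ x ξ =
      covectorCoeff x₁ x ξ * deriv (chartTransition x₀ x₁) (chartAt ℂ x₀ x) := by
  have hx := mem_chart_source ℂ x
  have h := deriv_chartTransition_comp hx h₁ h₀
  have hne1 := deriv_chartTransition_ne_zero hx h₁
  have hne2 := deriv_chartTransition_ne_zero hx h₀
  have hm := deriv_chartTransition_mul h₁ h₀
  rw [covectorCoeff, covectorCoeff, div_mul_eq_mul_div, div_eq_div_iff hne2 hne1, h]
  linear_combination (-covectorForm ξ 1 * deriv (chartTransition x x₁) (chartAt ℂ x x)) * hm

/-- The derivative of a curve in the coordinate at `x₀`, in terms of the preferred coordinate. -/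
lemma hasDerivWithinAt_chart_of_preferred {path : ℝ → X} {s : Set ℝ} {t : ℝ} {v : ℂ}
    (hc : ContinuousWithinAt path s t) {x₁ x₀ : X} (h₁ : path t ∈ (chartAt ℂ x₁).source)
    (h₀ : path t ∈ (chartAt ℂ x₀).source)
    (hv : HasDerivWithinAt (fun u => chartAt ℂ x₁ (path u)) v s t) :
    HasDerivWithinAt (fun u => chartAt ℂ x₀ (path u))
      (deriv (chartTransition x₁ x₀) (chartAt ℂ x₁ (path t)) * v) s t := by
  have hd := (differentiableAt_chartTransition h₁ h₀).hasDerivAt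
  have h := hd.comp_hasDerivWithinAt t hv
  refine h.congr_of_eventuallyEq ?_ ?_
  · filter_upwards [hc ((chartAt ℂ x₁).open_source.mem_nhds h₁)] with u hu
    exact (chartTransition_apply hu).symm
  · exact (chartTransition_apply h₁).symm

end charts

namespace SpectralCurve

variable {X : Type*} [TopologicalSpace X] [ChartedSpace ℂ X]

/-! ### The spectral curve in a chart -/

/-- The local equation of the spectral curve in the coordinate at `x₀`. -/
noncomputable def eqn (C : SpectralCurve X) (x₀ : X) : ℂ × ℂ → ℂ :=
  cubicEq (C.local_equation x₀).choose (C.local_equation x₀).choose_spec.choose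

lemma contDiffAt_eqn (C : SpectralCurve X) (x₀ : X) {q : ℂ × ℂ} (hq : q.1 ∈ (chartAt ℂ x₀).target) :
    ContDiffAt ℂ ω (C.eqn x₀) q :=
  let h := (C.local_equation x₀).choose_spec.choose_spec
  contDiffAt_cubicEq (chartAt ℂ x₀).open_target h.1 h.2.1 hq

lemma fderiv_eqn_ne_zero (C : SpectralCurve X) (x₀ : X) {q : ℂ × ℂ}
    (hq : q.1 ∈ (chartAt ℂ x₀).target) (h0 : C.eqn x₀ q = 0) :
    fderiv ℂ (C.eqn x₀) q (0, 1) ≠ 0 ∨ fderiv ℂ (C.eqn x₀) q (1, 0) ≠ 0 :=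
  let h := (C.local_equation x₀).choose_spec.choose_spec
  fderiv_cubicEq_ne_zero (chartAt ℂ x₀).open_target h.1 h.2.1 h.2.2.2 hq h0

lemma smul_mem_fiber_iff (C : SpectralCurve X) {x₀ x : X} (hx : x ∈ (chartAt ℂ x₀).source)
    (c : ℂ) : c • coordForm x₀ x ∈ C.fiber x ↔ C.eqn x₀ (chartAt ℂ x₀ x, c) = 0 :=
  (C.local_equation x₀).choose_spec.choose_spec.2.2.1 x hx c

/-! ### Local primitives of the tautological form -/

/-- An open piece of the spectral curve with a primitive of the tautological form. -/
structure Patch (C : SpectralCurve X) where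
  center : X
  dom : Set (ℂ × ℂ)
  isOpen_dom : IsOpen dom
  prim : ℂ × ℂ → ℂ
  isLocalPrimitive : IsLocalPrimitive (C.eqn center) dom prim

namespace Patch

variable {C : SpectralCurve X}

/-- The point `(x, ξ)` of the cotangent bundle lies in the patch. -/
def Mem (k : C.Patch) (x : X) (ξ : Cotangent X x) : Prop :=
  x ∈ (chartAt ℂ k.center).source ∧ cotangentCoord k.center x ξ ∈ k.dom

/-- The value of the primitive of the tautological form. -/
noncomputable def val (k : C.Patch) (x : X) (ξ : Cotangent X x) : ℂ :=
  k.prim (cotangentCoord k.center x ξ)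

/-- The value of the primitive on the sheet `γ dz`, as a function of the coordinate `z` at `x₀`. -/
noncomputable def sheetVal (k : C.Patch) (x₀ : X) (γ : ℂ → ℂ) (z : ℂ) : ℂ :=
  k.val ((chartAt ℂ x₀).symm z) (γ z • coordForm x₀ ((chartAt ℂ x₀).symm z))

lemma val_congr (k : C.Patch) {x₀ x y : X} (h : x = y) (c : ℂ) :
    k.val x (c • coordForm x₀ x) = k.val y (c • coordForm x₀ y) := by
  rw [h]

end Patch

lemma exists_patch (C : SpectralCurve X) (x₀ : X) {q : ℂ × ℂ} (hq : q.1 ∈ (chartAt ℂ x₀).target)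
    (h0 : C.eqn x₀ q = 0) : ∃ k : C.Patch, k.center = x₀ ∧ q ∈ k.dom := by
  have hΩ : IsOpen {p : ℂ × ℂ | p.1 ∈ (chartAt ℂ x₀).target} :=
    (chartAt ℂ x₀).open_target.preimage continuous_fst
  obtain ⟨V, G, hV, hqV, -, hG⟩ := exists_isLocalPrimitive hΩ
    (fun p hp => C.contDiffAt_eqn x₀ hp) hq h0 (C.fderiv_eqn_ne_zero x₀ hq h0)
  exact ⟨⟨x₀, V, hV, G, hG⟩, rfl, hqV⟩

/-! ### Lifts of paths to the spectral curve -/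

/-- `ξ` is a sheet of the spectral curve along `path`, continuous at the parameter `t`. -/
structure IsLiftAt (C : SpectralCurve X) {ι : Type*} [TopologicalSpace ι] (path : ι → X)
    (ξ : ∀ t, Cotangent X (path t)) (s : Set ι) (t₀ : ι) : Prop where
  mem : t₀ ∈ s
  continuousWithinAt : ContinuousWithinAt path s t₀
  eventually_mem : ∀ᶠ t in 𝓝[s] t₀, ξ t ∈ C.fiber (path t)
  exists_coeff : ∃ (x₁ : X) (c : ι → ℂ), path t₀ ∈ (chartAt ℂ x₁).source ∧
    ContinuousWithinAt c s t₀ ∧ ∀ᶠ t in 𝓝[s] t₀, ξ t = c t • coordForm x₁ (path t)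

namespace Leaf

variable {C : SpectralCurve X}

lemma isLiftAt_fst (l : C.Leaf) {t : ℝ} (ht : t ∈ Set.Icc (0 : ℝ) 1) :
    C.IsLiftAt l.path l.fst (Set.Icc 0 1) t := by
  obtain ⟨c, hc, hc'⟩ := l.continuous_fst t ht
  exact ⟨ht, l.continuousOn_path t ht,
    Filter.eventually_of_mem self_mem_nhdsWithin fun u hu => l.fst_mem u hu,
    l.path t, c, mem_chart_source ℂ _, hc, hc'⟩

lemma isLiftAt_snd (l : C.Leaf) {t : ℝ} (ht : t ∈ Set.Icc (0 : ℝ) 1) :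
    C.IsLiftAt l.path l.snd (Set.Icc 0 1) t := by
  obtain ⟨c, hc, hc'⟩ := l.continuous_snd t ht
  exact ⟨ht, l.continuousOn_path t ht,
    Filter.eventually_of_mem self_mem_nhdsWithin fun u hu => l.snd_mem u hu,
    l.path t, c, mem_chart_source ℂ _, hc, hc'⟩

end Leaf

variable [IsManifold 𝓘(ℂ) ω X]

lemma mem_fiber_iff (C : SpectralCurve X) {x₀ x : X} (hx : x ∈ (chartAt ℂ x₀).source)
    (ξ : Cotangent X x) : ξ ∈ C.fiber x ↔ C.eqn x₀ (cotangentCoord x₀ x ξ) = 0 := by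
  rw [cotangentCoord, ← C.smul_mem_fiber_iff hx, covectorCoeff_smul_coordForm hx]

/-- The coefficients of three distinct sheets over a point which is not a branch point. -/
lemma exists_three_coeff (C : SpectralCurve X) {x₀ x : X} (hx : x ∈ (chartAt ℂ x₀).source)
    (hb : x ∉ C.branch) : ∃ c d e : ℂ, c ≠ d ∧ c ≠ e ∧ d ≠ e ∧
      c • coordForm x₀ x ∈ C.fiber x ∧ d • coordForm x₀ x ∈ C.fiber x ∧
      e • coordForm x₀ x ∈ C.fiber x := by
  have h3 : 2 < (C.fiber x).ncard := by
    simp only [branch, Set.mem_ofPred_eq, not_lt] at hb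
    omega
  obtain ⟨ξ, hξ, η, hη, ζ, hζ, h1, h2, h3⟩ :=
    (Set.two_lt_ncard (Set.finite_of_ncard_pos (by omega))).1 h3
  refine ⟨covectorCoeff x₀ x ξ, covectorCoeff x₀ x η, covectorCoeff x₀ x ζ,
    (covectorCoeff_injective hx).ne h1, (covectorCoeff_injective hx).ne h2,
    (covectorCoeff_injective hx).ne h3, ?_⟩
  simp only [covectorCoeff_smul_coordForm hx]
  exact ⟨hξ, hη, hζ⟩

lemma unramified_of_notMem_branch (C : SpectralCurve X) {x₀ x : X}
    (hx : x ∈ (chartAt ℂ x₀).source) (hb : x ∉ C.branch) {c : ℂ}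
    (hc : c • coordForm x₀ x ∈ C.fiber x) :
    fderiv ℂ (C.eqn x₀) (chartAt ℂ x₀ x, c) (0, 1) ≠ 0 := by
  obtain ⟨c₁, c₂, c₃, h12, h13, h23, h1, h2, h3⟩ := C.exists_three_coeff hx hb
  rw [C.smul_mem_fiber_iff hx] at h1 h2 h3 hc
  have h := (C.local_equation x₀).choose_spec.choose_spec
  rw [eqn, fderiv_cubicEq (chartAt ℂ x₀).open_target h.1 h.2.1 ((chartAt ℂ x₀).map_source hx)]
  simpa using cubic_unramified h1 h2 h3 h12 h13 h23 hc

namespace IsLiftAt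

variable {C : SpectralCurve X} {ι : Type*} [TopologicalSpace ι] {path : ι → X}
  {ξ : ∀ t, Cotangent X (path t)} {s : Set ι} {t₀ : ι}

/-- A lift is only required to have a continuous coefficient in one coordinate; coefficients in two
coordinates differ by the derivative of the transition map, which is analytic. -/
lemma continuousWithinAt_coord (h : C.IsLiftAt path ξ s t₀) {x₀ : X}
    (h₀ : path t₀ ∈ (chartAt ℂ x₀).source) :
    ContinuousWithinAt (fun t => cotangentCoord x₀ (path t) (ξ t)) s t₀ := by
  obtain ⟨x₁, c, h₁, hc, hξ⟩ := h.exists_coeff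
  refine ContinuousWithinAt.prodMk ?_ ?_
  · exact ((chartAt ℂ x₀).continuousAt h₀).comp_continuousWithinAt h.continuousWithinAt
  · have hd : ContinuousWithinAt
        (fun t => deriv (chartTransition x₀ x₁) (chartAt ℂ x₀ (path t))) s t₀ :=
      (analyticAt_chartTransition h₀ h₁).deriv.continuousAt.comp_continuousWithinAt
        (f := fun t => chartAt ℂ x₀ (path t))
        (((chartAt ℂ x₀).continuousAt h₀).comp_continuousWithinAt h.continuousWithinAt)
    have key : ∀ᶠ t in 𝓝[s] t₀, covectorCoeff x₀ (path t) (ξ t) =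
        c t * deriv (chartTransition x₀ x₁) (chartAt ℂ x₀ (path t)) := by
      filter_upwards [hξ, h.continuousWithinAt ((chartAt ℂ x₁).open_source.mem_nhds h₁),
        h.continuousWithinAt ((chartAt ℂ x₀).open_source.mem_nhds h₀)] with t ht ht1 ht0
      rw [covectorCoeff_change ht1 ht0, ht, covectorCoeff_smul ht1]
    exact (hc.mul hd).congr_of_eventuallyEq key (key.self_of_nhdsWithin h.mem)

end IsLiftAt

namespace Patch

variable {C : SpectralCurve X}

lemma sheetVal_chart (k : C.Patch) {x₀ x : X} (hx : x ∈ (chartAt ℂ x₀).source) {γ : ℂ → ℂ}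
    {ξ : Cotangent X x} (h : γ (chartAt ℂ x₀ x) = covectorCoeff x₀ x ξ) :
    k.sheetVal x₀ γ (chartAt ℂ x₀ x) = k.val x ξ := by
  rw [sheetVal, k.val_congr ((chartAt ℂ x₀).left_inv hx), h, covectorCoeff_smul_coordForm hx]

section lift

variable {ι : Type*} [TopologicalSpace ι] {path : ι → X}
  {ξ : ∀ t, Cotangent X (path t)} {s : Set ι} {t₀ : ι}

lemma eventually_mem (k : C.Patch) (h : C.IsLiftAt path ξ s t₀) (hk : k.Mem (path t₀) (ξ t₀)) :
    ∀ᶠ t in 𝓝[s] t₀, k.Mem (path t) (ξ t) := by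
  filter_upwards [h.continuousWithinAt ((chartAt ℂ k.center).open_source.mem_nhds hk.1),
    h.continuousWithinAt_coord hk.1 (k.isOpen_dom.mem_nhds hk.2)] with t h1 h2
  exact ⟨h1, h2⟩

lemma continuousWithinAt_val (k : C.Patch) (h : C.IsLiftAt path ξ s t₀)
    (hk : k.Mem (path t₀) (ξ t₀)) :
    ContinuousWithinAt (fun t => k.val (path t) (ξ t)) s t₀ :=
  ContinuousAt.comp_continuousWithinAt (f := fun t => cotangentCoord k.center (path t) (ξ t))
    (k.isLocalPrimitive.continuousOn.continuousAt (k.isOpen_dom.mem_nhds hk.2))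
    (h.continuousWithinAt_coord hk.1)

/-- Near an unramified point a continuous lift stays on one sheet, so along it the primitive depends
on the base coordinate alone. This permits the chain rule without differentiability of the lift
itself. -/
lemma exists_hasDerivAt_val (k : C.Patch) (h : C.IsLiftAt path ξ s t₀)
    (hk : k.Mem (path t₀) (ξ t₀)) (hb : path t₀ ∉ C.branch) :
    ∃ g : ℂ → ℂ,
      HasDerivAt g (covectorCoeff k.center (path t₀) (ξ t₀)) (chartAt ℂ k.center (path t₀)) ∧
      ∀ᶠ t in 𝓝[s] t₀, k.val (path t) (ξ t) = g (chartAt ℂ k.center (path t)) := by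
  have hf := h.eventually_mem.self_of_nhdsWithin h.mem
  have hu := C.unramified_of_notMem_branch (c := covectorCoeff k.center (path t₀) (ξ t₀)) hk.1 hb
    (by rwa [covectorCoeff_smul_coordForm hk.1])
  obtain ⟨g, hg, hg'⟩ := k.isLocalPrimitive.exists_hasDerivAt _ hk.2
    ((C.mem_fiber_iff hk.1 _).1 hf) hu
  refine ⟨g, hg, ?_⟩
  filter_upwards [h.continuousWithinAt_coord hk.1 hg', h.eventually_mem,
    h.continuousWithinAt ((chartAt ℂ k.center).open_source.mem_nhds hk.1)] with t h1 h2 h3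
  exact h1 ((C.mem_fiber_iff h3 _).1 h2)

end lift

/-- The derivative of the primitive along a lifted curve is the value of the sheet on the
velocity. -/
lemma hasDerivWithinAt_val (k : C.Patch) {path : ℝ → X} {ξ : ∀ t, Cotangent X (path t)}
    {s : Set ℝ} {t₀ : ℝ} (h : C.IsLiftAt path ξ s t₀) (hk : k.Mem (path t₀) (ξ t₀))
    (hb : path t₀ ∉ C.branch) {v : ℂ}
    (hv : HasDerivWithinAt (fun u => chartAt ℂ (path t₀) (path u)) v s t₀) :
    HasDerivWithinAt (fun t => k.val (path t) (ξ t)) (covectorForm (ξ t₀) v) s t₀ := by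
  obtain ⟨g, hg, hg'⟩ := k.exists_hasDerivAt_val h hk hb
  have hz := hasDerivWithinAt_chart_of_preferred h.continuousWithinAt
    (mem_chart_source ℂ (path t₀)) hk.1 hv
  rw [covectorForm_apply hk.1]
  exact (hg.comp_hasDerivWithinAt t₀ hz).congr_of_eventuallyEq hg'
    (hg'.self_of_nhdsWithin h.mem)

/-- The derivative of the primitive along a holomorphic sheet. -/
lemma hasDerivAt_val_sheet (k : C.Patch) {x₀ : X} {γ : ℂ → ℂ} {z : ℂ}
    (hz : z ∈ (chartAt ℂ x₀).target) (hγ : ContinuousAt γ z)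
    (hγ0 : ∀ᶠ w in 𝓝 z, C.eqn x₀ (w, γ w) = 0) (hb : (chartAt ℂ x₀).symm z ∉ C.branch)
    (hk : k.Mem ((chartAt ℂ x₀).symm z) (γ z • coordForm x₀ ((chartAt ℂ x₀).symm z))) :
    HasDerivAt (k.sheetVal x₀ γ) (γ z) z ∧
    ∀ᶠ w in 𝓝 z, k.Mem ((chartAt ℂ x₀).symm w)
      (γ w • coordForm x₀ ((chartAt ℂ x₀).symm w)) := by
  have hs : (chartAt ℂ x₀).symm z ∈ (chartAt ℂ x₀).source := (chartAt ℂ x₀).map_target hz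
  have htarget := (chartAt ℂ x₀).open_target.mem_nhds hz
  have hl : C.IsLiftAt (fun w => (chartAt ℂ x₀).symm w)
      (fun w => γ w • coordForm x₀ ((chartAt ℂ x₀).symm w)) Set.univ z := by
    refine ⟨Set.mem_univ z, ((chartAt ℂ x₀).continuousAt_symm hz).continuousWithinAt, ?_,
      x₀, γ, hs, hγ.continuousWithinAt, Filter.Eventually.of_forall fun _ => rfl⟩
    rw [nhdsWithin_univ]
    filter_upwards [hγ0, htarget] with w hw hw'
    rwa [C.smul_mem_fiber_iff ((chartAt ℂ x₀).map_target hw'), (chartAt ℂ x₀).right_inv hw']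
  refine ⟨?_, by simpa [nhdsWithin_univ] using k.eventually_mem hl hk⟩
  obtain ⟨g, hg, hg'⟩ := k.exists_hasDerivAt_val hl hk hb
  rw [nhdsWithin_univ] at hg'
  have hd := (differentiableAt_chartTransition hs hk.1).hasDerivAt
  rw [(chartAt ℂ x₀).right_inv hz] at hd
  have hcomp := HasDerivAt.comp (h₂ := g) z hg hd
  have hcoef : covectorCoeff k.center ((chartAt ℂ x₀).symm z)
      (γ z • coordForm x₀ ((chartAt ℂ x₀).symm z)) * deriv (chartTransition x₀ k.center) z = γ z := by
    have h1 := covectorCoeff_change hk.1 hs (γ z • coordForm x₀ ((chartAt ℂ x₀).symm z))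
    rw [covectorCoeff_smul hs, (chartAt ℂ x₀).right_inv hz] at h1
    exact h1.symm
  rw [hcoef] at hcomp
  exact hcomp.congr_of_eventuallyEq hg'

end Patch

/-- The spectral curve is covered by countably many patches. -/
lemma exists_countable_patches [SecondCountableTopology X] (C : SpectralCurve X) :
    ∃ I : Set C.Patch, I.Countable ∧ ∀ x, ∀ ξ ∈ C.fiber x, ∃ k ∈ I, k.Mem x ξ := by
  obtain ⟨t, htc, ht⟩ := TopologicalSpace.countable_cover_nhds (α := X)
    (f := fun x => (chartAt ℂ x).source) (fun x => chart_source_mem_nhds ℂ x)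
  have h (x₀ : X) : ∃ I : Set C.Patch, I.Countable ∧
      ∀ x ∈ (chartAt ℂ x₀).source, ∀ ξ ∈ C.fiber x, ∃ k ∈ I, k.Mem x ξ := by
    let T := {q : ℂ × ℂ // q.1 ∈ (chartAt ℂ x₀).target ∧ C.eqn x₀ q = 0}
    choose k hkc hkd using fun q : T => C.exists_patch x₀ q.2.1 q.2.2
    obtain ⟨t, htc, ht⟩ := TopologicalSpace.countable_cover_nhds (α := T)
      (f := fun q => Subtype.val ⁻¹' (k q).dom)
      (fun q => (((k q).isOpen_dom).preimage continuous_subtype_val).mem_nhds (hkd q))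
    refine ⟨k '' t, htc.image k, fun x hx ξ hξ => ?_⟩
    have hq : (⟨cotangentCoord x₀ x ξ, (chartAt ℂ x₀).map_source hx,
      (C.mem_fiber_iff hx ξ).1 hξ⟩ : T) ∈ ⋃ q ∈ t, Subtype.val ⁻¹' (k q).dom := by
      rw [ht]; trivial
    obtain ⟨q, hqt, hq⟩ := Set.mem_iUnion₂.1 hq
    refine ⟨k q, ⟨q, hqt, rfl⟩, ?_⟩
    rw [Patch.Mem, hkc q]
    exact ⟨hx, hq⟩
  choose I hIc hI using h
  refine ⟨⋃ x₀ ∈ t, I x₀, htc.biUnion fun x₀ _ => hIc x₀, fun x ξ hξ => ?_⟩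
  have hx : x ∈ ⋃ x₀ ∈ t, (chartAt ℂ x₀).source := by rw [ht]; trivial
  obtain ⟨x₀, hx₀, hx⟩ := Set.mem_iUnion₂.1 hx
  obtain ⟨k, hk, hkm⟩ := hI x₀ x hx ξ hξ
  exact ⟨k, Set.mem_biUnion hx₀ hk, hkm⟩

/-! ### Sheets near a point which is not a branch point -/

/-- A sheet of the spectral curve near a point which is not a branch point. -/
lemma exists_sheet (C : SpectralCurve X) {x₀ x : X} (hx : x ∈ (chartAt ℂ x₀).source)
    (hb : x ∉ C.branch) {ξ : Cotangent X x} (hξ : ξ ∈ C.fiber x) :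
    ∃ γ : ℂ → ℂ, AnalyticAt ℂ γ (chartAt ℂ x₀ x) ∧
      γ (chartAt ℂ x₀ x) = covectorCoeff x₀ x ξ ∧
      (∀ᶠ z in 𝓝 (chartAt ℂ x₀ x), C.eqn x₀ (z, γ z) = 0) ∧
      ∀ᶠ q in 𝓝 (cotangentCoord x₀ x ξ), C.eqn x₀ q = 0 → q.2 = γ q.1 := by
  have hu := C.unramified_of_notMem_branch (c := covectorCoeff x₀ x ξ) hx hb
    (by rwa [covectorCoeff_smul_coordForm hx])
  exact exists_analyticAt_graph (C.contDiffAt_eqn x₀ ((chartAt ℂ x₀).map_source hx))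
    ((C.mem_fiber_iff hx ξ).1 hξ) hu

/-- The difference of the primitives of the tautological form in two patches, on two sheets `γ`, `δ`
near a point, is a primitive of the difference of the two sheets. -/
lemma exists_ball_hasDerivAt_sub (C : SpectralCurve X) (hB : IsClosed C.branch) (k l : C.Patch)
    {x₀ x : X} (hx : x ∈ (chartAt ℂ x₀).source) (hb : x ∉ C.branch) {γ δ : ℂ → ℂ}
    (hγ : AnalyticAt ℂ γ (chartAt ℂ x₀ x)) (hδ : AnalyticAt ℂ δ (chartAt ℂ x₀ x))
    (hγ0 : ∀ᶠ z in 𝓝 (chartAt ℂ x₀ x), C.eqn x₀ (z, γ z) = 0)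
    (hδ0 : ∀ᶠ z in 𝓝 (chartAt ℂ x₀ x), C.eqn x₀ (z, δ z) = 0)
    (hk : k.Mem x (γ (chartAt ℂ x₀ x) • coordForm x₀ x))
    (hl : l.Mem x (δ (chartAt ℂ x₀ x) • coordForm x₀ x)) :
    ∃ r > 0, ∀ z ∈ Metric.ball (chartAt ℂ x₀ x) r,
      z ∈ (chartAt ℂ x₀).target ∧ (chartAt ℂ x₀).symm z ∉ C.branch ∧
      AnalyticAt ℂ γ z ∧ AnalyticAt ℂ δ z ∧ C.eqn x₀ (z, γ z) = 0 ∧ C.eqn x₀ (z, δ z) = 0 ∧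
      HasDerivAt (fun w => k.sheetVal x₀ γ w - l.sheetVal x₀ δ w) (γ z - δ z) z := by
  have hz := (chartAt ℂ x₀).map_source hx
  have hxz := (chartAt ℂ x₀).left_inv hx
  have hk' := (k.hasDerivAt_val_sheet hz hγ.continuousAt hγ0 (by rwa [hxz]) (by rwa [hxz])).2
  have hl' := (l.hasDerivAt_val_sheet hz hδ.continuousAt hδ0 (by rwa [hxz]) (by rwa [hxz])).2
  have hball := ((((((chartAt ℂ x₀).open_target.eventually_mem hz).and
    (eventually_chart_symm_mem hx (hB.isOpen_compl.mem_nhds hb))).and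
    (hγ.eventually_analyticAt.and hδ.eventually_analyticAt)).and
    (hγ0.eventually_nhds.and hδ0.eventually_nhds)).and (hk'.and hl'))
  obtain ⟨r, hr, hball⟩ := Metric.eventually_nhds_iff_ball.1 hball
  refine ⟨r, hr, fun z hzr => ?_⟩
  obtain ⟨⟨⟨⟨h1, h2⟩, h3, h4⟩, h5, h6⟩, h7, h8⟩ := hball z hzr
  exact ⟨h1, h2, h3, h4, h5.self_of_nhds, h6.self_of_nhds,
    (k.hasDerivAt_val_sheet h1 h3.continuousAt h5 h2 h7).1.sub
      (l.hasDerivAt_val_sheet h1 h4.continuousAt h6 h2 h8).1⟩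

/-- On the overlap of two patches, the difference of the primitives is locally constant, and takes
only countably many values. -/
lemma countable_overlap (C : SpectralCurve X) (hB : C.branch.Finite) [T2Space X]
    (hF : ∀ x ∈ C.branch, (C.fiber x).Countable) (k l : C.Patch) :
    {w : ℂ | ∃ x, ∃ ξ ∈ C.fiber x, k.Mem x ξ ∧ l.Mem x ξ ∧ w = k.val x ξ - l.val x ξ}.Countable := by
  -- Branch points are set aside, since no sheet there need be a graph over the base. There are
  -- finitely many, with countable fibres, so they add only countably many values.
  set T : Set (Σ x, Cotangent X x) :=
    {y | y.1 ∉ C.branch ∧ y.2 ∈ C.fiber y.1 ∧ k.Mem y.1 y.2 ∧ l.Mem y.1 y.2} with hT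
  have h1 : ((fun y : Σ x, Cotangent X x => k.val y.1 y.2 - l.val y.1 y.2) '' T).Countable := by
    refine countable_image_of_locally_constant T (fun y => cotangentCoord k.center y.1 y.2) _ ?_
    rintro ⟨x, ξ⟩ ⟨hb, hξ, hk, hl⟩
    obtain ⟨γ, hγ, hγx, hγ0, hγu⟩ := C.exists_sheet hk.1 hb hξ
    have hsm : γ (chartAt ℂ k.center x) • coordForm k.center x = ξ := by
      rw [hγx, covectorCoeff_smul_coordForm hk.1]
    obtain ⟨r, hr, hball⟩ := C.exists_ball_hasDerivAt_sub hB.isClosed k l hk.1 hb hγ hγ hγ0 hγ0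
      (by rwa [hsm]) (by rwa [hsm])
    refine ⟨_, Filter.inter_mem hγu (continuous_fst.continuousAt
      (Metric.ball_mem_nhds (cotangentCoord k.center x ξ).1 hr)), ?_⟩
    rintro ⟨x', ξ'⟩ ⟨hb', hξ', hk', hl'⟩ ⟨hu', hr'⟩
    -- Both primitives are taken on the same sheet `γ`, so their difference has derivative `γ - γ =
    -- 0`.
    have hconst := Metric.isOpen_ball.is_const_of_deriv_eq_zero
      (convex_ball (chartAt ℂ k.center x) r).isPreconnected
      (fun z hz => (hball z hz).2.2.2.2.2.2.differentiableAt.differentiableWithinAt)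
      (fun z hz => by simpa using (hball z hz).2.2.2.2.2.2.deriv) hr' (Metric.mem_ball_self hr)
    have e' : γ (chartAt ℂ k.center x') = covectorCoeff k.center x' ξ' :=
      (hu' ((C.mem_fiber_iff hk'.1 _).1 hξ')).symm
    exact (congrArg₂ (· - ·) (k.sheetVal_chart hk'.1 e') (l.sheetVal_chart hk'.1 e')).symm.trans
      (hconst.trans (congrArg₂ (· - ·) (k.sheetVal_chart hk.1 hγx) (l.sheetVal_chart hk.1 hγx)))
  have h2 : (⋃ x ∈ C.branch, (fun ξ => k.val x ξ - l.val x ξ) '' C.fiber x).Countable :=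
    hB.countable.biUnion fun x hx => (hF x hx).image _
  refine (h1.union h2).mono ?_
  rintro w ⟨x, ξ, hξ, hk, hl, rfl⟩
  by_cases hb : x ∈ C.branch
  · exact Or.inr (Set.mem_biUnion hb ⟨ξ, hξ, rfl⟩)
  · exact Or.inl ⟨⟨x, ξ⟩, ⟨hb, hξ, hk, hl⟩, rfl⟩

/-! ### Segments of foliation lines -/

namespace Leaf

variable {C : SpectralCurve X}

/-- The real part of the difference of the primitives on the two sheets is locally constant along a
foliation line. -/
lemma eventually_re_val_eq (l : C.Leaf) (k k' : C.Patch) {t₀ : ℝ} (ht₀ : t₀ ∈ Set.Icc (0 : ℝ) 1)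
    (hk : k.Mem (l.path t₀) (l.fst t₀)) (hk' : k'.Mem (l.path t₀) (l.snd t₀)) :
    ∀ᶠ t in 𝓝[Set.Icc 0 1] t₀, k.Mem (l.path t) (l.fst t) ∧ k'.Mem (l.path t) (l.snd t) ∧
      (k.val (l.path t) (l.fst t) - k'.val (l.path t) (l.snd t)).re =
        (k.val (l.path t₀) (l.fst t₀) - k'.val (l.path t₀) (l.snd t₀)).re := by
  have hev := (k.eventually_mem (l.isLiftAt_fst ht₀) hk).and
    (k'.eventually_mem (l.isLiftAt_snd ht₀) hk')
  obtain ⟨ε, hε, hball⟩ := Metric.mem_nhdsWithin_iff.1 hev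
  set J : Set ℝ := Metric.ball t₀ ε ∩ Set.Icc 0 1 with hJ
  have hJo : J.OrdConnected :=
    ((convex_ball t₀ ε).inter (convex_Icc (0 : ℝ) 1)).ordConnected
  set g : ℝ → ℝ := fun t => (k.val (l.path t) (l.fst t) - k'.val (l.path t) (l.snd t)).re with hg
  have hcont : ContinuousOn g J := fun t ht =>
    (Complex.continuous_re.continuousAt.comp_continuousWithinAt
      ((k.continuousWithinAt_val (l.isLiftAt_fst ht.2) (hball ht).1).sub
        (k'.continuousWithinAt_val (l.isLiftAt_snd ht.2) (hball ht).2))).mono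
      Set.inter_subset_right
  have hder : ∀ t ∈ J, t ∈ Set.Ioo (0 : ℝ) 1 → HasDerivAt g 0 t := by
    intro t ht ht'
    have hb := l.not_branch t ht'
    have h1 := (k.hasDerivWithinAt_val (l.isLiftAt_fst ht.2) (hball ht).1 hb
      (l.hasDeriv t ht.2 hb)).sub
      (k'.hasDerivWithinAt_val (l.isLiftAt_snd ht.2) (hball ht).2 hb (l.hasDeriv t ht.2 hb))
    have h2 := (Complex.reCLM.hasFDerivAt.comp_hasDerivWithinAt t h1).hasDerivAt
      (Icc_mem_nhds ht'.1 ht'.2)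
    have h3 : Complex.reCLM (covectorForm (l.fst t) (l.vel t) - covectorForm (l.snd t) (l.vel t))
        = 0 := l.re_eq_zero t ht.2 hb
    rw [h3] at h2
    exact h2
  -- The ends of the segment may be branch points, where no velocity is given. The mean value
  -- theorem needs only continuity there.
  have hconst : ∀ a ∈ J, ∀ b ∈ J, a < b → g a = g b := by
    intro a ha b hb hab
    obtain ⟨c, hc, hc'⟩ := exists_hasDerivAt_eq_slope g (fun _ => 0) hab
      (hcont.mono (hJo.out ha hb))
      (fun x hx => hder x (hJo.out ha hb ⟨hx.1.le, hx.2.le⟩)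
        ⟨ha.2.1.trans_lt hx.1, hx.2.trans_le hb.2.2⟩)
    have hne : b - a ≠ 0 := by linarith [sub_pos.2 hab]
    rw [eq_comm, div_eq_zero_iff] at hc'
    linarith [hc'.resolve_right hne]
  have ht₀J : t₀ ∈ J := ⟨Metric.mem_ball_self hε, ht₀⟩
  have hJm : J ∈ 𝓝[Set.Icc 0 1] t₀ :=
    Filter.inter_mem (mem_nhdsWithin_of_mem_nhds (Metric.ball_mem_nhds t₀ hε)) self_mem_nhdsWithin
  filter_upwards [hJm] with t ht
  refine ⟨(hball ht).1, (hball ht).2, ?_⟩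
  rcases lt_trichotomy t t₀ with h | h | h
  · exact hconst t ht t₀ ht₀J h
  · rw [h]
  · exact (hconst t₀ ht₀J t ht h).symm

end Leaf

end SpectralCurve

namespace SpectralCurve

variable {X : Type*} [TopologicalSpace X] [ChartedSpace ℂ X]

/-! ### The multivalued potential of the real part of the tautological form -/

section potential

variable [IsManifold 𝓘(ℂ) ω X]

lemma countable_fiber (C : SpectralCurve X) (x : X) : (C.fiber x).Countable := by
  have hx := mem_chart_source ℂ x
  rcases (C.fiber x).eq_empty_or_nonempty with h | ⟨ξ, hξ⟩
  · simp [h]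
  · obtain ⟨a, b, -, -, h, -⟩ := C.local_equation x
    have hmem : C.fiber x ⊆ covectorCoeff x x ⁻¹'
        {c : ℂ | c ^ 3 + a (chartAt ℂ x x) * c + b (chartAt ℂ x x) = 0} := by
      intro η hη
      rw [Set.mem_preimage, Set.mem_ofPred_eq]
      rw [← h x hx, covectorCoeff_smul_coordForm hx]
      exact hη
    have hfin : {c : ℂ | c ^ 3 + a (chartAt ℂ x x) * c + b (chartAt ℂ x x) = 0}.Finite := by
      set p : Polynomial ℂ := Polynomial.X ^ 3 + Polynomial.C (a (chartAt ℂ x x)) * Polynomial.X +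
        Polynomial.C (b (chartAt ℂ x x)) with hp
      have hp0 : p ≠ 0 := by
        have h3 : p.coeff 3 = 1 := by
          simp [hp]
        intro h0
        simp [h0] at h3
      refine (p.roots.toFinset.finite_toSet).subset fun c hc => ?_
      simp only [Finset.mem_coe, Multiset.mem_toFinset, Polynomial.mem_roots hp0,
        Polynomial.IsRoot.def]
      simpa [hp] using hc
    exact Set.countable_of_injective_of_countable_image (covectorCoeff_injective hx).injOn
      (hfin.subset (Set.image_subset_iff.2 hmem)).countable

/-- The real parts of local primitives of the tautological form glue to a function on the spectral
curve with values in the quotient of `ℝ` by a countable subgroup. The subgroup can be chosen such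
that the values on the sheets over each point of a countable set coincide. -/
lemma exists_potential [SecondCountableTopology X] [T2Space X] (C : SpectralCurve X)
    (hB : C.branch.Finite) {T : Set X} (hT : T.Countable) :
    ∃ (P : Submodule ℚ ℝ) (pot : ∀ x, Cotangent X x → ℝ ⧸ P) (I : Set C.Patch),
      (P : Set ℝ).Countable ∧ I.Countable ∧ (∀ x, ∀ ξ ∈ C.fiber x, ∃ k ∈ I, k.Mem x ξ) ∧
      (∀ k ∈ I, ∀ x, ∀ ξ ∈ C.fiber x, k.Mem x ξ → pot x ξ = P.mkQ (k.val x ξ).re) ∧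
      ∀ x ∈ T, ∀ ξ ∈ C.fiber x, ∀ η ∈ C.fiber x, pot x ξ = pot x η := by
  classical
  obtain ⟨I, hI, hcov⟩ := C.exists_countable_patches
  -- `A` collects the ambiguities of the primitive on overlaps of patches, and `A'` the differences
  -- between sheets over points of `T`. Both are countable.
  set A : Set ℂ := ⋃ k ∈ I, ⋃ l ∈ I,
    {w : ℂ | ∃ x, ∃ ξ ∈ C.fiber x, k.Mem x ξ ∧ l.Mem x ξ ∧ w = k.val x ξ - l.val x ξ} with hA
  set A' : Set ℂ := ⋃ k ∈ I, ⋃ l ∈ I, ⋃ x ∈ T, ⋃ ξ ∈ C.fiber x, ⋃ η ∈ C.fiber x,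
    {k.val x ξ - l.val x η} with hA'
  have hAc : A.Countable := hI.biUnion fun k _ => hI.biUnion fun l _ =>
    C.countable_overlap hB (fun x _ => C.countable_fiber x) k l
  have hA'c : A'.Countable := hI.biUnion fun k _ => hI.biUnion fun l _ => hT.biUnion fun x _ =>
    (C.countable_fiber x).biUnion fun ξ _ => (C.countable_fiber x).biUnion fun η _ =>
      Set.countable_singleton _
  set R : Set ℝ := Complex.re '' (A ∪ A') with hR
  have hRc : Countable R := ((hAc.union hA'c).image _).to_subtype
  have hPc : ((Submodule.span ℚ R : Submodule ℚ ℝ) : Set ℝ).Countable := by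
    have : Countable (Submodule.span ℚ (Set.range ((↑) : R → ℝ))) := inferInstance
    rw [Subtype.range_coe] at this
    exact Set.countable_coe_iff.1 this
  -- The rational span is still countable. Unlike the subgroup generated by `R`, it gives a
  -- torsion-free quotient, so a nonzero integer multiple of the flux can be divided out.
  set P : Submodule ℚ ℝ := Submodule.span ℚ R with hP
  refine ⟨P, fun x ξ => if h : ∃ k ∈ I, k.Mem x ξ then P.mkQ (h.choose.val x ξ).re else 0, I,
    hPc, hI, hcov, ?_, ?_⟩
  · intro k hk x ξ hξ hkm
    have h : ∃ k ∈ I, k.Mem x ξ := ⟨k, hk, hkm⟩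
    dsimp only
    rw [dif_pos h, Submodule.mkQ_apply, Submodule.mkQ_apply, Submodule.Quotient.eq,
      ← Complex.sub_re]
    refine Submodule.subset_span ⟨_, Or.inl ?_, rfl⟩
    exact Set.mem_biUnion h.choose_spec.1 (Set.mem_biUnion hk
      ⟨x, ξ, hξ, h.choose_spec.2, hkm, rfl⟩)
  · intro x hx ξ hξ η hη
    have h := hcov x ξ hξ
    have h' := hcov x η hη
    dsimp only
    rw [dif_pos h, dif_pos h', Submodule.mkQ_apply, Submodule.mkQ_apply, Submodule.Quotient.eq,
      ← Complex.sub_re]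
    refine Submodule.subset_span ⟨_, Or.inr ?_, rfl⟩
    exact Set.mem_biUnion h.choose_spec.1 (Set.mem_biUnion h'.choose_spec.1
      (Set.mem_biUnion hx (Set.mem_biUnion hξ (Set.mem_biUnion hη rfl))))

/-- The difference of the potentials of the two sheets is constant along a foliation line. -/
lemma Leaf.potential_sub_eq {C : SpectralCurve X} (l : C.Leaf) {P : Submodule ℚ ℝ}
    {pot : ∀ x, Cotangent X x → ℝ ⧸ P} {I : Set C.Patch}
    (hcov : ∀ x, ∀ ξ ∈ C.fiber x, ∃ k ∈ I, k.Mem x ξ)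
    (hpot : ∀ k ∈ I, ∀ x, ∀ ξ ∈ C.fiber x, k.Mem x ξ → pot x ξ = P.mkQ (k.val x ξ).re) :
    pot (l.path 0) (l.fst 0) - pot (l.path 0) (l.snd 0) =
      pot (l.path 1) (l.fst 1) - pot (l.path 1) (l.snd 1) := by
  have hloc : IsLocallyConstant (fun t : Set.Icc (0 : ℝ) 1 =>
      pot (l.path t) (l.fst t) - pot (l.path t) (l.snd t)) := by
    rw [IsLocallyConstant.iff_eventually_eq]
    rintro ⟨t₀, ht₀⟩
    obtain ⟨k, hk, hkm⟩ := hcov _ _ (l.fst_mem t₀ ht₀)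
    obtain ⟨k', hk', hkm'⟩ := hcov _ _ (l.snd_mem t₀ ht₀)
    have h := l.eventually_re_val_eq k k' ht₀ hkm hkm'
    filter_upwards [preimage_coe_mem_nhds_subtype.2 h] with t ⟨h1, h2, h3⟩
    have h4 := congrArg P.mkQ h3
    rw [Complex.sub_re, Complex.sub_re, map_sub, map_sub] at h4
    rw [hpot k hk _ _ (l.fst_mem t t.2) h1, hpot k' hk' _ _ (l.snd_mem t t.2) h2,
      hpot k hk _ _ (l.fst_mem t₀ ht₀) hkm, hpot k' hk' _ _ (l.snd_mem t₀ ht₀) hkm']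
    exact h4
  exact hloc.apply_eq_of_preconnectedSpace ⟨0, by simp⟩ ⟨1, by simp⟩

end potential

end SpectralCurve

/-! ### Collisions at 120 degrees -/

/-- The sign of the flat coordinates of a foliation direction: on the foliation `Re (c - d) = 0`
the real part of `c` is, with `Im (c - d) > 0`, a negative multiple of `Im (conj c * d)`. -/
lemma re_mul_im_conj_mul {c d w : ℂ} (hre : ((c - d) * w).re = 0) (him : 0 < ((c - d) * w).im)
    (h0 : (c * w).re ≠ 0) : 0 < -(c * w).re * ((starRingEnd ℂ c) * d).im := by
  -- With `(c - d) w = i t` one has `w = i t conj(c - d) / |c - d|²`; multiply by `c` and take real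
  -- parts.
  have h : -(c * w).re * Complex.normSq (c - d) =
      ((c - d) * w).im * ((starRingEnd ℂ c) * d).im := by
    simp only [Complex.normSq_apply, Complex.mul_re, Complex.mul_im, Complex.sub_re, Complex.sub_im,
      Complex.conj_re, Complex.conj_im] at hre ⊢
    linear_combination (c.re * (d.re - c.re) + c.im * (d.im - c.im)) * hre
  have hne : c - d ≠ 0 := by
    rintro h
    simp [h] at him
  have hpos := Complex.normSq_pos.2 hne
  have h2 : -(c * w).re * ((starRingEnd ℂ c) * d).im * Complex.normSq (c - d) =
      ((c - d) * w).im * ((starRingEnd ℂ c) * d).im ^ 2 := by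
    linear_combination ((starRingEnd ℂ c) * d).im * h
  have h3 : ((starRingEnd ℂ c) * d).im ≠ 0 := by
    intro h3
    rw [h3, mul_zero] at h
    rcases mul_eq_zero.1 h with h | h
    · exact h0 (neg_eq_zero.1 h)
    · exact hpos.ne' h
  refine pos_of_mul_pos_left ?_ hpos.le
  rw [h2]
  positivity

/-- A foliation direction in the flat coordinates. -/
lemma exists_flat_eq {c : Fin 3 → ℂ} (hc : ∑ i, c i = 0) {a b : Fin 3} {w : ℂ}
    (hre : ((c a - c b) * w).re = 0) (him : 0 < ((c a - c b) * w).im) :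
    ∃ (m : Fin 3) (κ : ℝ), (∀ k, (c k * w).re = κ * (if k = m then 2 else -1)) ∧
      (κ ≠ 0 → (a = m + 1 ∧ b = m + 2 ∧ 0 < κ * ((starRingEnd ℂ (c 0)) * c 1).im) ∨
        (a = m + 2 ∧ b = m + 1 ∧ κ * ((starRingEnd ℂ (c 0)) * c 1).im < 0)) := by
  have hab : a ≠ b := by
    rintro rfl
    simp at him
  have hS := re_mul_im_conj_mul hre him
  rw [Fin.sum_univ_three] at hc
  have hc2 : c 2 = -(c 0 + c 1) := by linear_combination hc
  have hsum (m : Fin 3) : (c m * w).re + (c (m + 1) * w).re + (c (m + 2) * w).re = 0 := by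
    have h : c m + c (m + 1) + c (m + 2) = 0 := by
      fin_cases m
      · exact hc
      · change c 1 + c 2 + c 0 = 0; linear_combination hc
      · change c 2 + c 0 + c 1 = 0; linear_combination hc
    rw [← Complex.add_re, ← Complex.add_re, ← add_mul, ← add_mul, h]
    simp
  -- As the three coefficients sum to zero, the oriented area of a cyclically consecutive pair does
  -- not depend on the pair. Its sign records the cyclic order of the sheets.
  have hcyc (m : Fin 3) : ((starRingEnd ℂ (c (m + 1))) * c (m + 2)).im =
      ((starRingEnd ℂ (c 0)) * c 1).im := by
    fin_cases m
    · change ((starRingEnd ℂ (c 1)) * c 2).im = _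
      rw [hc2]; simp; ring
    · change ((starRingEnd ℂ (c 2)) * c 0).im = _
      rw [hc2]; simp; ring
    · rfl
  rw [sub_mul, Complex.sub_re] at hre
  obtain ⟨m, hm⟩ : ∃ m : Fin 3, (a = m + 1 ∧ b = m + 2) ∨ (a = m + 2 ∧ b = m + 1) := by
    clear hre him hS hsum hcyc
    revert a b
    decide
  have hk (k : Fin 3) : k = m ∨ k = m + 1 ∨ k = m + 2 := by
    clear hm hsum hcyc
    revert k m
    decide
  have h01 : m + 1 ≠ m := by clear hm hsum hcyc hk; revert m; decide
  have h02 : m + 2 ≠ m := by clear hm hsum hcyc hk; revert m; decide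
  have hs := hsum m
  -- Here `m` is the sheet not involved in the foliation. The other two have equal real part `-κ` on
  -- `w`, so the vanishing sum gives `2κ` for the sheet `m`.
  refine ⟨m, -(c a * w).re, fun k => ?_, fun hκ => ?_⟩
  · rcases hm with ⟨rfl, rfl⟩ | ⟨rfl, rfl⟩ <;> rcases hk k with rfl | rfl | rfl <;>
      simp only [if_true, if_neg h01, if_neg h02] <;> linarith
  · have hS := hS (neg_ne_zero.1 hκ)
    rcases hm with ⟨rfl, rfl⟩ | ⟨rfl, rfl⟩
    · exact Or.inl ⟨rfl, rfl, by rwa [hcyc] at hS⟩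
    · refine Or.inr ⟨rfl, rfl, ?_⟩
      have hanti : ((starRingEnd ℂ (c (m + 2))) * c (m + 1)).im =
          -((starRingEnd ℂ (c (m + 1))) * c (m + 2)).im := by
        simp; ring
      rw [hanti, hcyc] at hS
      linarith

/-- Three foliation directions which pairwise make an angle of 120 degrees: every sheet occurs once
as the first and once as the second of an ordered pair of sheets. -/
lemma sum_sub_eq_zero_of_angle {c : Fin 3 → ℂ} (hc : ∑ i, c i = 0) {a b : Fin 3 → Fin 3}
    {w : Fin 3 → ℂ} (hre : ∀ i, ((c (a i) - c (b i)) * w i).re = 0)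
    (him : ∀ i, 0 < ((c (a i) - c (b i)) * w i).im)
    (hang : ∀ i j, i ≠ j → InnerProductGeometry.angle
      (WithLp.toLp 2 fun k => (c k * w i).re : EuclideanSpace ℝ (Fin 3))
      (WithLp.toLp 2 fun k => (c k * w j).re) = 2 * Real.pi / 3)
    {M : Type*} [AddCommGroup M] (f : Fin 3 → M) : ∑ i, (f (a i) - f (b i)) = 0 := by
  choose m κ hκ hor using fun i => exists_flat_eq hc (hre i) (him i)
  have hvec (i : Fin 3) : (WithLp.toLp 2 fun k => (c k * w i).re : EuclideanSpace ℝ (Fin 3)) =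
      κ i • WithLp.toLp 2 fun k => if k = m i then 2 else -1 := by
    ext k
    simp [hκ i k]
  simp only [hvec] at hang
  have hnorm (i : Fin 3) : ‖(WithLp.toLp 2 fun k => if k = i then 2 else -1 :
      EuclideanSpace ℝ (Fin 3))‖ ^ 2 = 6 := by
    rw [EuclideanSpace.norm_sq_eq]
    fin_cases i <;> simp [Fin.sum_univ_three] <;> norm_num
  have hinner (i j : Fin 3) (hij : i ≠ j) : inner ℝ
      (WithLp.toLp 2 fun k => if k = i then 2 else -1 : EuclideanSpace ℝ (Fin 3))
      (WithLp.toLp 2 fun k => if k = j then 2 else -1) = (-3 : ℝ) := by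
    fin_cases i <;> fin_cases j <;> simp [PiLp.inner_apply, Fin.sum_univ_three] at hij ⊢ <;>
      norm_num
  have hcos : Real.cos (2 * Real.pi / 3) = -(1 / 2) := by
    rw [show 2 * Real.pi / 3 = Real.pi - Real.pi / 3 by ring, Real.cos_pi_sub, Real.cos_pi_div_three]
  -- The angle with the zero vector is `π / 2` by convention, hence not `2π / 3`.
  have hne (i : Fin 3) : κ i ≠ 0 := by
    intro h0
    have h := hang i (i + 1) (by clear hor hvec h0; revert i; decide)
    rw [h0, zero_smul, InnerProductGeometry.angle_zero_left] at h
    linarith [Real.pi_pos]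
  -- With the same missing sheet the vectors would be parallel, with angle `0` or `π`. With
  -- different ones the model vectors have inner product `-3`, so a negative cosine means that the
  -- factors `κ` have equal sign.
  have hpair (i j : Fin 3) (hij : i ≠ j) : m i ≠ m j ∧ 0 < κ i * κ j := by
    have h := congrArg Real.cos (hang i j hij)
    rw [hcos, InnerProductGeometry.cos_angle, norm_smul, norm_smul, real_inner_smul_left,
      real_inner_smul_right] at h
    have hpos (i : Fin 3) : 0 < ‖(WithLp.toLp 2 fun k => if k = i then 2 else -1 :
      EuclideanSpace ℝ (Fin 3))‖ := by
      nlinarith [hnorm i, norm_nonneg (WithLp.toLp 2 fun k => if k = i then 2 else -1 :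
        EuclideanSpace ℝ (Fin 3))]
    have hi := norm_pos_iff.2 (hne i)
    have hj := norm_pos_iff.2 (hne j)
    have hi' := hpos (m i)
    have hj' := hpos (m j)
    have hlt : κ i * (κ j * inner ℝ
        (WithLp.toLp 2 fun k => if k = m i then 2 else -1 : EuclideanSpace ℝ (Fin 3))
        (WithLp.toLp 2 fun k => if k = m j then 2 else -1)) < 0 := by
      rw [div_eq_iff (by positivity)] at h
      rw [h]
      have : 0 < ‖κ i‖ * ‖(WithLp.toLp 2 fun k => if k = m i then 2 else -1 :
        EuclideanSpace ℝ (Fin 3))‖ * (‖κ j‖ * ‖(WithLp.toLp 2 fun k => if k = m j then 2 else -1 :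
        EuclideanSpace ℝ (Fin 3))‖) := by positivity
      linarith
    have hm : m i ≠ m j := by
      intro hm
      rw [div_eq_iff (by positivity), hm, real_inner_self_eq_norm_sq, hnorm] at h
      have h' : κ i * κ j * 6 = -3 * (‖κ i‖ * ‖κ j‖) := by
        have := hnorm (m j)
        linear_combination h - (1 / 2) * ‖κ i‖ * ‖κ j‖ * this
      have habs : ‖κ i‖ * ‖κ j‖ = |κ i * κ j| := by
        rw [abs_mul]; rfl
      rw [habs] at h'
      rcases abs_cases (κ i * κ j) with ⟨h1, h2⟩ | ⟨h1, h2⟩ <;> rw [h1] at h'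
      · have : κ i * κ j = 0 := by linarith
        exact (mul_ne_zero (hne i) (hne j)) this
      · have : κ i * κ j = 0 := by linarith
        exact (mul_ne_zero (hne i) (hne j)) this
    refine ⟨hm, ?_⟩
    rw [hinner _ _ hm] at hlt
    linarith
  have hinj : Function.Injective m := fun i j hij => by
    by_contra h
    exact (hpair i j h).1 hij
  have hshift (s : Fin 3) : ∑ i, f (m i + s) = ∑ i, f i :=
    (((Equiv.ofBijective m (Finite.injective_iff_bijective.1 hinj)).trans
      (Equiv.addRight s)).sum_comp f)
  have hsgn (i j : Fin 3) : 0 < κ i * κ j := by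
    by_cases h : i = j
    · rw [h]; exact mul_self_pos.2 (hne j)
    · exact (hpair i j h).2
  rw [Finset.sum_sub_distrib, sub_eq_zero]
  -- All `κ i` share one sign, so all three pairs are `(m + 1, m + 2)` or all are `(m + 2, m + 1)`.
  -- Since `m` is a permutation, the sums over first and second sheets coincide.
  rcases hor 0 (hne 0) with ⟨-, -, h0⟩ | ⟨-, -, h0⟩
  · have h (i : Fin 3) : a i = m i + 1 ∧ b i = m i + 2 := by
      rcases hor i (hne i) with ⟨h1, h2, -⟩ | ⟨-, -, h3⟩
      · exact ⟨h1, h2⟩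
      · nlinarith [hsgn 0 i, mul_pos h0 (neg_pos.2 h3), sq_nonneg ((starRingEnd ℂ (c 0)) * c 1).im]
    simp only [fun i => (h i).1, fun i => (h i).2, hshift]
  · have h (i : Fin 3) : a i = m i + 2 ∧ b i = m i + 1 := by
      rcases hor i (hne i) with ⟨-, -, h3⟩ | ⟨h1, h2, -⟩
      · nlinarith [hsgn 0 i, mul_pos h3 (neg_pos.2 h0), sq_nonneg ((starRingEnd ℂ (c 0)) * c 1).im]
      · exact ⟨h1, h2⟩
    simp only [fun i => (h i).1, fun i => (h i).2, hshift]

namespace SpectralCurve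

variable {X : Type*} [TopologicalSpace X] [ChartedSpace ℂ X] {C : SpectralCurve X}

/-! ### Half-edges -/

namespace Leaf.Departs

variable {l : C.Leaf} {b : Bool} {x : X} {α β : Cotangent X x} {w : TangentSpace 𝓘(ℂ) x}

lemma mem_fiber (h : l.Departs b x α β w) : α ∈ C.fiber x ∧ β ∈ C.fiber x := by
  cases h with
  | start => exact ⟨l.fst_mem 0 (by simp), l.snd_mem 0 (by simp)⟩
  | finish => exact ⟨l.snd_mem 1 (by simp), l.fst_mem 1 (by simp)⟩

lemma re_eq_zero (h : l.Departs b x α β w) (hx : x ∉ C.branch) : ((α - β) w).re = 0 := by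
  cases h with
  | start => exact l.re_eq_zero 0 (by simp) hx
  | finish =>
    have h := l.re_eq_zero 1 (by simp) hx
    rw [map_neg, ← neg_sub (l.fst 1) (l.snd 1)]
    change (-(-((l.fst 1 - l.snd 1) (l.vel 1)))).re = 0
    rw [neg_neg, h]

lemma im_pos (h : l.Departs b x α β w) (hx : x ∉ C.branch) : 0 < ((α - β) w).im := by
  cases h with
  | start => exact l.im_pos 0 (by simp) hx
  | finish =>
    have h := l.im_pos 1 (by simp) hx
    rw [map_neg, ← neg_sub (l.fst 1) (l.snd 1)]
    change 0 < (-(-((l.fst 1 - l.snd 1) (l.vel 1)))).im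
    rwa [neg_neg]

lemma unique (h : l.Departs b x α β w) {α' β' : Cotangent X x} {w' : TangentSpace 𝓘(ℂ) x}
    (h' : l.Departs b x α' β' w') : α = α' ∧ β = β' := by
  cases h with
  | start => cases h' with
    | start => exact ⟨rfl, rfl⟩
  | finish => cases h' with
    | finish => exact ⟨rfl, rfl⟩

end Leaf.Departs

/-- The difference of the values of `pot` on the two sheets at a half-edge. -/
def Leaf.halfEdgeFlux {M : Type*} [AddCommGroup M] (pot : ∀ x, Cotangent X x → M) (l : C.Leaf) :
    Bool → M
  | false => pot (l.path 0) (l.fst 0) - pot (l.path 0) (l.snd 0)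
  | true => pot (l.path 1) (l.snd 1) - pot (l.path 1) (l.fst 1)

lemma Leaf.Departs.halfEdgeFlux_eq {M : Type*} [AddCommGroup M] (pot : ∀ x, Cotangent X x → M)
    {l : C.Leaf} {b : Bool} {x : X} {α β : Cotangent X x} {w : TangentSpace 𝓘(ℂ) x}
    (h : l.Departs b x α β w) : l.halfEdgeFlux pot b = pot x α - pot x β := by
  cases h <;> rfl

/-! ### Vertices -/

namespace SingularSet

/-- The local form of a spectral network graph at a vertex with the set `A` of half-edges. -/
def VertexForm (S : C.SingularSet) {E : Type} (leaf : E → C.Leaf) (A : Set (E × Bool)) (x : X) :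
    Prop :=
  (∃ h : E × Bool, A = {h} ∧ x ∈ S.points ∧
      ∃ α β w, (leaf h.1).Departs h.2 x α β w ∧
        (x ∈ C.branch → α = β) ∧ (x ∉ C.branch → S.foliation x = {α, β})) ∨
    (∃ h k : E × Bool, h ≠ k ∧ A = {h, k} ∧ x ∉ C.branch ∧
      ∃ α β w w', (leaf h.1).Departs h.2 x α β w ∧ (leaf k.1).Departs k.2 x β α w') ∨
    (∃ h : Fin 3 → E × Bool, Function.Injective h ∧ A = Set.range h ∧ x ∉ C.branch ∧
      ∃ (α β : Fin 3 → Cotangent X x) (w : Fin 3 → TangentSpace 𝓘(ℂ) x),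
        (∀ i, (leaf (h i).1).Departs (h i).2 x (α i) (β i) (w i)) ∧ C.Meet120 x w)

/-- An endpoint at `p`, with the ordered pair of sheets `(α, β)`. -/
def EndsAt {E : Type} (leaf : E → C.Leaf) (A : Set (E × Bool)) (x : X) {p : X}
    (α β : Cotangent X p) : Prop :=
  x = p ∧ ∃ h : E × Bool, A = {h} ∧ ∃ w, (leaf h.1).Departs h.2 p α β w

variable {E : Type} {leaf : E → C.Leaf} {A : Set (E × Bool)} {x : X}

/-- Only endpoints at `p` are new, and they split into two classes according to which sheet of the
unordered pair `F` comes first on the outgoing half-edge. -/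
lemma VertexForm.of_adjoin {S : C.SingularSet} {p : X} {F : Set (Cotangent X p)}
    {hF : C.IsFoliationAt p F} (hp : p ∉ C.branch) {α₀ β₀ : Cotangent X p} (hF' : F = {α₀, β₀})
    (hne : α₀ ≠ β₀) (h : (S.adjoin p F hF).VertexForm leaf A x) :
    EndsAt leaf A x α₀ β₀ ∨ EndsAt leaf A x β₀ α₀ ∨ S.VertexForm leaf A x := by
  classical
  rcases h with ⟨h, hA, hx, α, β, w, hd, hb, hb'⟩ | h | h
  · by_cases hxp : x = p
    · subst hxp
      have h1 : ({α₀, β₀} : Set (Cotangent X x)) = {α, β} := by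
        rw [← hF', ← hb' hp]
        simp [adjoin]
      rcases Set.pair_eq_pair_iff.1 h1 with ⟨rfl, rfl⟩ | ⟨rfl, rfl⟩
      · exact Or.inl ⟨rfl, h, hA, w, hd⟩
      · exact Or.inr (Or.inl ⟨rfl, h, hA, w, hd⟩)
    · refine Or.inr (Or.inr (Or.inl ⟨h, hA, hx.resolve_left hxp, α, β, w, hd, hb, fun hxb => ?_⟩))
      rw [← hb' hxb]
      simp [adjoin, Function.update_of_ne hxp]
  · exact Or.inr (Or.inr (Or.inr (Or.inl h)))
  · exact Or.inr (Or.inr (Or.inr (Or.inr h)))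

/-- Exchanging the sheets reverses the direction of a foliation line, so two endpoints with opposite
pairs leave `p` on opposite sides of one line and fit together into a subdivision point. -/
lemma EndsAt.vertexForm_of_swap {S : C.SingularSet} {p : X} (hp : p ∉ C.branch)
    {α β : Cotangent X p} {A' : Set (E × Bool)} {x' : X} (h : EndsAt leaf A x α β)
    (h' : EndsAt leaf A' x' β α) (hAA' : Disjoint A A') : S.VertexForm leaf (A ∪ A') x := by
  obtain ⟨rfl, h, rfl, w, hd⟩ := h
  obtain ⟨-, k, rfl, w', hd'⟩ := h'
  exact Or.inr (Or.inl ⟨h, k, by simpa using hAA', rfl, hp, α, β, w, w', hd, hd'⟩)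

lemma EndsAt.not_swap {p : X} {α β : Cotangent X p} (hne : α ≠ β) (h : EndsAt leaf A x α β) :
    ¬ EndsAt leaf A x β α := by
  rintro ⟨-, k, hk, w', hd'⟩
  obtain ⟨-, h, hA, w, hd⟩ := h
  obtain rfl : h = k := Set.singleton_injective (hA.symm.trans hk)
  exact hne (hd.unique hd').1

lemma EndsAt.sum_flux {M : Type*} [AddCommGroup M] (pot : ∀ x, Cotangent X x → M) {p : X}
    {α β : Cotangent X p} {B : Finset (E × Bool)} (h : EndsAt leaf (B : Set (E × Bool)) x α β) :
    ∑ h ∈ B, (leaf h.1).halfEdgeFlux pot h.2 = pot p α - pot p β := by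
  obtain ⟨-, h, hA, w, hd⟩ := h
  rw [Finset.coe_eq_singleton.1 hA, Finset.sum_singleton, hd.halfEdgeFlux_eq pot]

variable [IsManifold 𝓘(ℂ) ω X]

/-- In the preferred coordinate a covector is multiplication by its coefficient, and the
coefficients of the three sheets sum to zero. This reduces the claim to `sum_sub_eq_zero_of_angle`.
-/
lemma sum_sub_eq_zero_of_meet120 {M : Type*} [AddCommGroup M] (f : Cotangent X x → M)
    {α β : Fin 3 → Cotangent X x} {w : Fin 3 → TangentSpace 𝓘(ℂ) x} (hα : ∀ i, α i ∈ C.fiber x)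
    (hβ : ∀ i, β i ∈ C.fiber x) (hre : ∀ i, ((α i - β i) (w i)).re = 0)
    (him : ∀ i, 0 < ((α i - β i) (w i)).im) (h : C.Meet120 x w) :
    ∑ i, (f (α i) - f (β i)) = 0 := by
  obtain ⟨s, hs, hsr, hang⟩ := h
  rw [← hsr] at hα hβ
  choose a ha using hα
  choose b hb using hβ
  have hxs := mem_chart_source ℂ x
  set c : Fin 3 → ℂ := fun i => covectorCoeff x x (s i) with hc
  let W : Fin 3 → ℂ := w
  have happ (ξ : Cotangent X x) (v : ℂ) : covectorForm ξ v = covectorCoeff x x ξ * v := by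
    have := covectorForm_apply hxs ξ v
    rwa [deriv_chartTransition_self hxs, one_mul] at this
  have hsub (i : Fin 3) : (α i - β i) (w i) = (c (a i) - c (b i)) * W i := by
    change covectorForm (α i) (W i) - covectorForm (β i) (W i) = _
    rw [happ, happ, ← ha, ← hb, sub_mul]
  have hflat (i : Fin 3) : flat s (w i) = WithLp.toLp 2 fun k => (c k * W i).re := by
    unfold flat
    congr 1
    funext k
    exact congrArg Complex.re (happ (s k) (W i))
  obtain ⟨A, B, -, -, heq, -⟩ := C.local_equation x
  have hroot (i : Fin 3) : c i ^ 3 + A (chartAt ℂ x x) * c i + B (chartAt ℂ x x) = 0 := by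
    rw [← heq x hxs, hc, covectorCoeff_smul_coordForm hxs, ← hsr]
    exact ⟨i, rfl⟩
  have hcinj : Function.Injective c := (covectorCoeff_injective hxs).comp hs
  have hc0 : ∑ i, c i = 0 := by
    rw [Fin.sum_univ_three]
    exact cubic_sum_eq_zero (hroot 0) (hroot 1) (hroot 2) (hcinj.ne (by decide))
      (hcinj.ne (by decide)) (hcinj.ne (by decide))
  have key := sum_sub_eq_zero_of_angle hc0 (a := a) (b := b) (w := W)
    (fun i => by rw [← hsub]; exact hre i) (fun i => by rw [← hsub]; exact him i)
    (fun i j hij => by rw [← hflat, ← hflat]; exact hang i j hij) (fun i => f (s i))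
  simpa only [ha, hb] using key

/-- The total flux at a vertex vanishes, except at endpoints over which `pot` depends on the
sheet. -/
lemma VertexForm.sum_flux {M : Type*} [AddCommGroup M] {S : C.SingularSet}
    {pot : ∀ x, Cotangent X x → M}
    (hpot : ∀ x ∈ S.points, ∀ ξ ∈ C.fiber x, ∀ η ∈ C.fiber x, pot x ξ = pot x η)
    {B : Finset (E × Bool)} (h : S.VertexForm leaf (B : Set (E × Bool)) x) :
    ∑ h ∈ B, (leaf h.1).halfEdgeFlux pot h.2 = 0 := by
  classical
  rcases h with ⟨h, hA, hx, α, β, w, hd, -, -⟩ | ⟨h, k, hhk, hA, -, α, β, w, w', hd, hd'⟩ |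
    ⟨h, hinj, hA, hx, α, β, w, hd, hm⟩
  · rw [Finset.coe_eq_singleton.1 hA, Finset.sum_singleton, hd.halfEdgeFlux_eq pot,
      hpot x hx _ hd.mem_fiber.1 _ hd.mem_fiber.2, sub_self]
  · have hB : B = {h, k} := by
      rw [← Finset.coe_inj, hA]; simp
    rw [hB, Finset.sum_pair hhk, hd.halfEdgeFlux_eq pot, hd'.halfEdgeFlux_eq pot]
    abel
  · have hB : B = Finset.univ.image h := by
      rw [← Finset.coe_inj, hA]; simp
    rw [hB, Finset.sum_image fun i _ j _ hij => hinj hij]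
    simp only [fun i => (hd i).halfEdgeFlux_eq pot]
    exact sum_sub_eq_zero_of_meet120 (pot x) (fun i => (hd i).mem_fiber.1)
      (fun i => (hd i).mem_fiber.2) (fun i => (hd i).re_eq_zero hx) (fun i => (hd i).im_pos hx) hm

/-! ### Flux balance at an added singularity -/

/-- If a new singularity `p` creates BPS states, then the flux at `p` vanishes: otherwise the
endpoints at `p` could be joined in pairs. -/
lemma flux_eq_zero_of_hasBPSState {M : Type*} [AddCommGroup M] [Module ℚ M] {S : C.SingularSet}
    (hS : ¬ S.HasBPSState) {pot : ∀ x, Cotangent X x → M}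
    (hleaf : ∀ l : C.Leaf, pot (l.path 0) (l.fst 0) - pot (l.path 0) (l.snd 0) =
      pot (l.path 1) (l.fst 1) - pot (l.path 1) (l.snd 1))
    (hpot : ∀ x ∈ S.points, ∀ ξ ∈ C.fiber x, ∀ η ∈ C.fiber x, pot x ξ = pot x η)
    {p : X} (hp : p ∉ C.branch) {F : Set (Cotangent X p)} (hF : C.IsFoliationAt p F)
    {α β : Cotangent X p} (hF' : F = {α, β}) (hne : α ≠ β)
    (h : (S.adjoin p F hF).HasBPSState) : pot p α - pot p β = 0 := by
  classical
  obtain ⟨B⟩ := h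
  have := B.finite_edge
  have := B.finite_vertex
  have := Fintype.ofFinite B.Edge
  have := Fintype.ofFinite B.Vertex
  set fib : B.Vertex → Set (B.Edge × Bool) := fun v => B.vertex ⁻¹' {v} with hfib
  have hform (v : B.Vertex) := VertexForm.of_adjoin hp hF' hne (B.local_form v)
  set Vp : B.Vertex → Prop := fun v => EndsAt B.leaf (fib v) (B.position v) α β with hVp
  set Vm : B.Vertex → Prop := fun v => EndsAt B.leaf (fib v) (B.position v) β α with hVm
  have hdisj (v : B.Vertex) (h : Vp v) : ¬ Vm v := EndsAt.not_swap hne h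
  have hcard : Fintype.card {v // Vm v} ≠ Fintype.card {v // Vp v} := by
    intro hcard
    obtain ⟨e⟩ := Fintype.card_eq.1 hcard
    refine hS ⟨{
      Edge := B.Edge
      Vertex := {v // ¬ Vm v}
      finite_edge := B.finite_edge
      nonempty_edge := B.nonempty_edge
      finite_vertex := inferInstance
      leaf := B.leaf
      -- Each endpoint with pair `(β, α)` is identified with its partner under `e`, an endpoint with
      -- pair `(α, β)`; edges are unchanged.
      vertex := fun h => if hv : Vm (B.vertex h) then
        ⟨e ⟨B.vertex h, hv⟩, hdisj _ (e ⟨B.vertex h, hv⟩).2⟩ else ⟨B.vertex h, hv⟩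
      position := fun v => B.position v
      local_form := ?_ }⟩
    rintro ⟨v, hv⟩
    by_cases hvp : Vp v
    · set u := e.symm ⟨v, hvp⟩ with hu
      have huv : (u : B.Vertex) ≠ v := fun h => hv (h ▸ u.2)
      have hset : (fun h => if hv : Vm (B.vertex h) then
          (⟨e ⟨B.vertex h, hv⟩, hdisj _ (e ⟨B.vertex h, hv⟩).2⟩ : {v // ¬ Vm v})
          else ⟨B.vertex h, hv⟩) ⁻¹' {⟨v, hv⟩} = fib v ∪ fib u := by
        ext h
        simp only [Set.mem_preimage, Set.mem_singleton_iff, Set.mem_union, hfib]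
        split_ifs with hm
        · have h1 : B.vertex h ≠ v := fun h => hv (h ▸ hm)
          rw [Subtype.mk.injEq]
          constructor
          · intro h2
            refine Or.inr ?_
            have : e ⟨B.vertex h, hm⟩ = ⟨v, hvp⟩ := Subtype.ext h2
            rw [hu, ← this, Equiv.symm_apply_apply]
          · rintro (h2 | h2)
            · exact absurd h2 h1
            · have : (⟨B.vertex h, hm⟩ : {v // Vm v}) = u := Subtype.ext h2
              rw [this, hu, Equiv.apply_symm_apply]
        · have h1 : B.vertex h ≠ u := fun h => hm (h ▸ u.2)
          simp [h1]
      have hd : Disjoint (fib v) (fib u) := by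
        rw [Set.disjoint_left]
        intro h h1 h2
        exact huv (h2.symm.trans h1)
      exact cast (congrArg (fun A => S.VertexForm B.leaf A (B.position v)) hset.symm)
        (EndsAt.vertexForm_of_swap hp hvp u.2 hd)
    · have hset : (fun h => if hv : Vm (B.vertex h) then
          (⟨e ⟨B.vertex h, hv⟩, hdisj _ (e ⟨B.vertex h, hv⟩).2⟩ : {v // ¬ Vm v})
          else ⟨B.vertex h, hv⟩) ⁻¹' {⟨v, hv⟩} = fib v := by
        ext h
        simp only [Set.mem_preimage, Set.mem_singleton_iff, hfib]
        split_ifs with hm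
        · have h1 : B.vertex h ≠ v := fun h => hv (h ▸ hm)
          have h2 : (e ⟨B.vertex h, hm⟩ : B.Vertex) ≠ v := fun h2 => hvp (h2 ▸ (e _).2)
          simp [h1, h2]
        · simp
      exact cast (congrArg (fun A => S.VertexForm B.leaf A (B.position v)) hset.symm)
        (((hform v).resolve_left hvp).resolve_left hv)
  -- Grouped by edges: the flux is constant along a segment and its two ends are counted with
  -- opposite orientation.
  have hsum : ∑ h : B.Edge × Bool, (B.leaf h.1).halfEdgeFlux pot h.2 = 0 := by
    rw [Fintype.sum_prod_type]
    refine Finset.sum_eq_zero fun l _ => ?_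
    rw [Fintype.sum_bool]
    simp only [Leaf.halfEdgeFlux, hleaf (B.leaf l)]
    abel
  have hv (v : B.Vertex) :
      ∑ h ∈ Finset.univ.filter (fun h => B.vertex h = v), (B.leaf h.1).halfEdgeFlux pot h.2 =
      (if Vp v then (pot p α - pot p β) else 0) - (if Vm v then (pot p α - pot p β) else 0) := by
    have hcoe : ((Finset.univ.filter (fun h => B.vertex h = v) : Finset (B.Edge × Bool)) :
        Set (B.Edge × Bool)) = fib v := by
      ext h; simp [hfib]
    by_cases h1 : Vp v
    · rw [if_pos h1, if_neg (hdisj v h1), sub_zero]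
      refine EndsAt.sum_flux (x := B.position v) pot ?_
      rw [hcoe]; exact h1
    · by_cases h2 : Vm v
      · rw [if_neg h1, if_pos h2, zero_sub, neg_sub]
        refine EndsAt.sum_flux (x := B.position v) pot ?_
        rw [hcoe]; exact h2
      · rw [if_neg h1, if_neg h2, sub_zero]
        refine VertexForm.sum_flux (S := S) (x := B.position v) hpot ?_
        rw [hcoe]; exact ((hform v).resolve_left h1).resolve_left h2
  -- Grouped by vertices, the same sum is the difference of the two endpoint counts times the flux
  -- at `p`. Passing to rational scalars lets this nonzero difference be cancelled.
  rw [← Finset.sum_fiberwise _ B.vertex, Finset.sum_congr rfl fun v _ => hv v,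
    Finset.sum_sub_distrib, ← Finset.sum_filter, ← Finset.sum_filter, Finset.sum_const,
    Finset.sum_const, ← Fintype.card_subtype, ← Fintype.card_subtype,
    ← Nat.cast_smul_eq_nsmul ℚ, ← Nat.cast_smul_eq_nsmul ℚ, ← sub_smul] at hsum
  refine (smul_eq_zero.1 hsum).resolve_left ?_
  exact fun h => hcard (Nat.cast_injective (sub_eq_zero.1 h)).symm

end SingularSet

end SpectralCurve

namespace SpectralCurve

variable {X : Type*} [TopologicalSpace X] [ChartedSpace ℂ X] [IsManifold 𝓘(ℂ) ω X]
  {C : SpectralCurve X}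

/-! ### The caustic in a chart -/

/-- Away from the branch points, the caustic is the locus where two sheets have real ratio. -/
lemma im_conj_mul_eq_zero_of_mem_caustic {x₀ x : X} (hx : x ∈ (chartAt ℂ x₀).source)
    (h : x ∈ C.caustic) {α β : Cotangent X x} (hα : α ∈ C.fiber x) (hβ : β ∈ C.fiber x)
    (hne : α ≠ β) :
    ((starRingEnd ℂ (covectorCoeff x₀ x α)) * covectorCoeff x₀ x β).im = 0 := by
  obtain ⟨hb, v, hv, hall⟩ := h
  have h3 : 2 < (C.fiber x).ncard := by
    simp only [branch, Set.mem_ofPred_eq, not_lt] at hb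
    omega
  obtain ⟨ζ, hζ, hζα, hζβ⟩ : ∃ ζ ∈ C.fiber x, α ≠ ζ ∧ β ≠ ζ := by
    by_contra! hc
    have hsub : C.fiber x ⊆ {α, β} := fun ζ hζ => by
      by_cases h : α = ζ
      · exact Or.inl h.symm
      · exact Or.inr (hc ζ hζ h).symm
    have := Set.ncard_le_ncard hsub
    rw [Set.ncard_pair hne] at this
    omega
  have hinj := covectorCoeff_injective hx
  set V : ℂ := deriv (chartTransition x x₀) (chartAt ℂ x x) * (show ℂ from v) with hV
  have hV0 : V ≠ 0 := mul_ne_zero (deriv_chartTransition_ne_zero (mem_chart_source ℂ x) hx) hv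
  have happ (ξ η : Cotangent X x) (hξ : ξ ∈ C.fiber x) (hη : η ∈ C.fiber x) :
      (covectorCoeff x₀ x ξ * V).re = (covectorCoeff x₀ x η * V).re := by
    have h1 : (covectorForm ξ (show ℂ from v) - covectorForm η (show ℂ from v)).re = 0 :=
      hall ξ hξ η hη
    rw [covectorForm_apply hx, covectorForm_apply hx, Complex.sub_re] at h1
    exact sub_eq_zero.1 h1
  have hroot (ξ : Cotangent X x) (hξ : ξ ∈ C.fiber x) := (C.mem_fiber_iff hx ξ).1 hξ
  have hsum := cubic_sum_eq_zero (hroot α hα) (hroot β hβ) (hroot ζ hζ) (hinj.ne hne)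
    (hinj.ne hζα) (hinj.ne hζβ)
  simp only [cotangentCoord] at hsum
  set c := covectorCoeff x₀ x α
  set d := covectorCoeff x₀ x β
  have hsum' : (c * V).re + (d * V).re + (covectorCoeff x₀ x ζ * V).re = 0 := by
    rw [← Complex.add_re, ← Complex.add_re, ← add_mul, ← add_mul, hsum]
    simp
  -- The real parts on the common tangent direction are equal and sum to zero, hence vanish. Thus
  -- `c` and `d` both lie on the real line of numbers whose product with `V` is imaginary.
  have hc : (c * V).re = 0 := by
    linarith [happ α β hα hβ, happ α ζ hα hζ]
  have hd : (d * V).re = 0 := by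
    linarith [happ α β hα hβ, happ α ζ hα hζ]
  have hN := Complex.normSq_pos.2 hV0
  have key : ((starRingEnd ℂ c) * d).im * Complex.normSq V = 0 := by
    simp only [Complex.normSq_apply, Complex.mul_re, Complex.mul_im, Complex.conj_re,
      Complex.conj_im] at hc hd ⊢
    linear_combination (d.re * V.im + d.im * V.re) * hc - (c.re * V.im + c.im * V.re) * hd
  exact (mul_eq_zero.1 key).resolve_right hN.ne'

/-- If `c` and `d` have real ratio, then `i` times the conjugate of a nonzero one is a direction on
which both have zero real part. The third sheet is `-c - d`, so it does as well. -/
lemma mem_caustic_of_im_conj_mul_eq_zero {x₀ x : X} (hx : x ∈ (chartAt ℂ x₀).source)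
    (hb : x ∉ C.branch) {c d : ℂ} (hc : c • coordForm x₀ x ∈ C.fiber x)
    (hd : d • coordForm x₀ x ∈ C.fiber x) (hne : c ≠ d)
    (h : ((starRingEnd ℂ c) * d).im = 0) : x ∈ C.caustic := by
  rw [C.smul_mem_fiber_iff hx] at hc hd
  obtain ⟨V, hV, hcV, hdV⟩ : ∃ V : ℂ, V ≠ 0 ∧ (c * V).re = 0 ∧ (d * V).re = 0 := by
    by_cases h0 : c = 0
    · refine ⟨Complex.I * starRingEnd ℂ d, ?_, by simp [h0], ?_⟩
      · refine mul_ne_zero Complex.I_ne_zero ((map_ne_zero _).2 ?_)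
        rintro rfl
        exact hne h0
      · simp; ring
    · refine ⟨Complex.I * starRingEnd ℂ c, mul_ne_zero Complex.I_ne_zero ((map_ne_zero _).2 h0),
        ?_, ?_⟩
      · simp; ring
      · simp at h ⊢
        linarith
  have hall (ξ : Cotangent X x) (hξ : ξ ∈ C.fiber x) : (covectorCoeff x₀ x ξ * V).re = 0 := by
    have hf := (C.mem_fiber_iff hx ξ).1 hξ
    by_cases h1 : c = covectorCoeff x₀ x ξ
    · rw [← h1, hcV]
    by_cases h2 : d = covectorCoeff x₀ x ξ
    · rw [← h2, hdV]
    have := cubic_sum_eq_zero hc hd hf hne h1 h2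
    simp only [cotangentCoord] at this
    rw [show covectorCoeff x₀ x ξ = -c - d by linear_combination this, sub_mul, neg_mul,
      Complex.sub_re, Complex.neg_re, hcV, hdV]
    simp
  have hJ := deriv_chartTransition_ne_zero (mem_chart_source ℂ x) hx
  refine ⟨hb, (show TangentSpace 𝓘(ℂ) x from
    V / deriv (chartTransition x x₀) (chartAt ℂ x x)), div_ne_zero hV hJ, ?_⟩
  intro ξ hξ η hη
  change (covectorForm ξ (V / deriv (chartTransition x x₀) (chartAt ℂ x x)) -
    covectorForm η (V / deriv (chartTransition x x₀) (chartAt ℂ x x))).re = 0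
  rw [covectorForm_apply hx, covectorForm_apply hx, mul_div_cancel₀ _ hJ, Complex.sub_re,
    hall ξ hξ, hall η hη, sub_zero]

/-! ### Segments of foliation lines in a chart -/

/-- A curve in a chart along which the difference of two sheets takes values in `i ℝ_{>0}` is a
segment of a foliation line. -/
lemma exists_leaf_of_chart {x₀ : X} {z z' : ℝ → ℂ} {γ δ : ℂ → ℂ}
    (hz : ∀ t ∈ Set.Icc (0 : ℝ) 1, HasDerivAt z (z' t) t)
    (htarget : ∀ t ∈ Set.Icc (0 : ℝ) 1, z t ∈ (chartAt ℂ x₀).target)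
    (hb : ∀ t ∈ Set.Icc (0 : ℝ) 1, (chartAt ℂ x₀).symm (z t) ∉ C.branch)
    (hγ : ∀ t ∈ Set.Icc (0 : ℝ) 1, ContinuousAt γ (z t))
    (hδ : ∀ t ∈ Set.Icc (0 : ℝ) 1, ContinuousAt δ (z t))
    (hγ0 : ∀ t ∈ Set.Icc (0 : ℝ) 1, C.eqn x₀ (z t, γ (z t)) = 0)
    (hδ0 : ∀ t ∈ Set.Icc (0 : ℝ) 1, C.eqn x₀ (z t, δ (z t)) = 0)
    (hre : ∀ t ∈ Set.Icc (0 : ℝ) 1, ((γ (z t) - δ (z t)) * z' t).re = 0)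
    (him : ∀ t ∈ Set.Icc (0 : ℝ) 1, 0 < ((γ (z t) - δ (z t)) * z' t).im) :
    ∃ l : C.Leaf, ∀ t, l.path t = (chartAt ℂ x₀).symm (z t) := by
  set path : ℝ → X := fun t => (chartAt ℂ x₀).symm (z t) with hpath
  have hsrc : ∀ t ∈ Set.Icc (0 : ℝ) 1, path t ∈ (chartAt ℂ x₀).source :=
    fun t ht => (chartAt ℂ x₀).map_target (htarget t ht)
  have hcoord : ∀ t ∈ Set.Icc (0 : ℝ) 1, chartAt ℂ x₀ (path t) = z t :=
    fun t ht => (chartAt ℂ x₀).right_inv (htarget t ht)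
  have hcont : ContinuousOn path (Set.Icc 0 1) := fun t ht =>
    (((chartAt ℂ x₀).continuousAt_symm (htarget t ht)).comp
      (hz t ht).continuousAt).continuousWithinAt
  have hmem (ε : ℂ → ℂ) (hε0 : ∀ t ∈ Set.Icc (0 : ℝ) 1, C.eqn x₀ (z t, ε (z t)) = 0) :
      ∀ t ∈ Set.Icc (0 : ℝ) 1, ε (z t) • coordForm x₀ (path t) ∈ C.fiber (path t) := by
    intro t ht
    rw [C.smul_mem_fiber_iff (hsrc t ht), hcoord t ht]
    exact hε0 t ht
  have hsheet (ε : ℂ → ℂ) (hε : ∀ t ∈ Set.Icc (0 : ℝ) 1, ContinuousAt ε (z t))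
      (hε0 : ∀ t ∈ Set.Icc (0 : ℝ) 1, C.eqn x₀ (z t, ε (z t)) = 0) :
      ∀ t₀ ∈ Set.Icc (0 : ℝ) 1, ∃ c : ℝ → ℂ, ContinuousWithinAt c (Set.Icc 0 1) t₀ ∧
        ∀ᶠ t in 𝓝[Set.Icc 0 1] t₀, ε (z t) • coordForm x₀ (path t) =
          c t • coordForm (path t₀) (path t) := by
    intro t₀ ht₀
    have hl : C.IsLiftAt path (fun t => ε (z t) • coordForm x₀ (path t)) (Set.Icc 0 1) t₀ :=
      ⟨ht₀, hcont t₀ ht₀, Filter.eventually_of_mem self_mem_nhdsWithin (hmem ε hε0), x₀,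
        fun t => ε (z t), hsrc t₀ ht₀,
        ((hε t₀ ht₀).comp (hz t₀ ht₀).continuousAt).continuousWithinAt,
        Filter.Eventually.of_forall fun _ => rfl⟩
    refine ⟨_, (hl.continuousWithinAt_coord (mem_chart_source ℂ (path t₀))).snd, ?_⟩
    filter_upwards [hcont t₀ ht₀ ((chartAt ℂ (path t₀)).open_source.mem_nhds
      (mem_chart_source ℂ (path t₀)))] with t ht
    exact (covectorCoeff_smul_coordForm ht _).symm
  set vel : ℝ → ℂ := fun t => deriv (chartTransition x₀ (path t)) (z t) * z' t with hvel
  have heval : ∀ t ∈ Set.Icc (0 : ℝ) 1, covectorForm (γ (z t) • coordForm x₀ (path t)) (vel t) -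
      covectorForm (δ (z t) • coordForm x₀ (path t)) (vel t) = (γ (z t) - δ (z t)) * z' t := by
    intro t ht
    have h1 := deriv_chartTransition_mul (mem_chart_source ℂ (path t)) (hsrc t ht)
    rw [hcoord t ht] at h1
    rw [covectorForm_smul_coordForm (hsrc t ht), covectorForm_smul_coordForm (hsrc t ht), hvel]
    linear_combination (γ (z t) - δ (z t)) * z' t * h1
  refine ⟨{
    path := path
    continuousOn_path := hcont
    not_branch := fun t ht => hb t (Set.Ioo_subset_Icc_self ht)
    fst := fun t => γ (z t) • coordForm x₀ (path t)
    snd := fun t => δ (z t) • coordForm x₀ (path t)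
    fst_mem := hmem γ hγ0
    snd_mem := hmem δ hδ0
    continuous_fst := hsheet γ hγ hγ0
    continuous_snd := hsheet δ hδ hδ0
    vel := vel
    hasDeriv := ?_
    re_eq_zero := fun t ht _ => ?_
    im_pos := fun t ht _ => ?_ }, fun t => rfl⟩
  · intro t ht _
    have h1 : HasDerivWithinAt (fun u => chartAt ℂ x₀ (path u)) (z' t) (Set.Icc 0 1) t :=
      (hz t ht).hasDerivWithinAt.congr hcoord (hcoord t ht)
    have h2 := hasDerivWithinAt_chart_of_preferred (hcont t ht) (hsrc t ht)
      (mem_chart_source ℂ (path t)) h1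
    rw [hcoord t ht] at h2
    exact h2
  · exact (congrArg Complex.re (heval t ht)).trans (hre t ht)
  · exact (him t ht).trans_eq (congrArg Complex.im (heval t ht)).symm

/-! ### Level sets of the flux on the caustic -/

/-- If the caustic does not run along a foliation line at `x`, then `x` is an isolated point of
each set of caustic points on which the flux is locally constant. -/
lemma exists_nhds_caustic_eq (hB : IsClosed C.branch) (k l : C.Patch) {x : X}
    (hx : x ∈ C.caustic) (hnl : ¬ CausticIsLeafAt C x) {α β : Cotangent X x}
    (hα : α ∈ C.fiber x) (hβ : β ∈ C.fiber x) (hne : α ≠ β) (hk : k.Mem x α) (hl : l.Mem x β) :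
    ∃ W ∈ 𝓝 (cotangentCoord k.center x α, cotangentCoord k.center x β),
      ∀ x' ∈ C.caustic, ∀ α' ∈ C.fiber x', ∀ β' ∈ C.fiber x', α' ≠ β' → k.Mem x' α' →
        (k.val x' α' - l.val x' β').re = (k.val x α - l.val x β).re →
        (cotangentCoord k.center x' α', cotangentCoord k.center x' β') ∈ W → x' = x := by
  have hb := hx.1
  set x₀ := k.center with hx₀
  have hxs : x ∈ (chartAt ℂ x₀).source := hk.1
  set z₀ := chartAt ℂ x₀ x with hz₀
  obtain ⟨γ, hγ, hγx, hγ0, hγu⟩ := C.exists_sheet hxs hb hα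
  obtain ⟨δ, hδ, hδx, hδ0, hδu⟩ := C.exists_sheet hxs hb hβ
  obtain ⟨r, hr, hball⟩ := C.exists_ball_hasDerivAt_sub hB k l hxs hb hγ hδ hγ0 hδ0
    (by rwa [hγx, covectorCoeff_smul_coordForm hxs]) (by rwa [hδx, covectorCoeff_smul_coordForm hxs])
  -- `Λ` is a primitive of `γ - δ`, which is nonzero at `z₀`, so it is a local coordinate. The
  -- foliation lines are its vertical lines, and the flux condition fixes its real part.
  set Λ : ℂ → ℂ := fun w => k.sheetVal x₀ γ w - l.sheetVal x₀ δ w with hΛ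
  have hΛd : ∀ z ∈ Metric.ball z₀ r, HasDerivAt Λ (γ z - δ z) z :=
    fun z hz => (hball z hz).2.2.2.2.2.2
  have hz₀b : z₀ ∈ Metric.ball z₀ r := Metric.mem_ball_self hr
  have hΛa : AnalyticAt ℂ Λ z₀ :=
    DifferentiableOn.analyticAt (s := Metric.ball z₀ r)
      (fun z hz => (hΛd z hz).differentiableAt.differentiableWithinAt)
      (Metric.ball_mem_nhds z₀ hr)
  have hΛ' : deriv Λ z₀ ≠ 0 := by
    rw [(hΛd z₀ hz₀b).deriv, hγx, hδx, sub_ne_zero]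
    exact (covectorCoeff_injective hxs).ne hne
  set w₀ := Λ z₀ with hw₀
  have hw₀v : w₀ = k.val x α - l.val x β := by
    rw [hw₀, hΛ, hz₀]
    exact congrArg₂ (· - ·) (k.sheetVal_chart hxs hγx) (l.sheetVal_chart hxs hδx)
  set h : ℂ → ℂ := hΛa.hasStrictDerivAt.localInverse _ _ _ hΛ' with hh
  have hha : AnalyticAt ℂ h w₀ := hΛa.analyticAt_localInverse hΛ'
  have hleft : ∀ᶠ z in 𝓝 z₀, h (Λ z) = z :=
    HasStrictDerivAt.eventually_left_inverse hΛa.hasStrictDerivAt hΛ'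
  have hright : ∀ᶠ w in 𝓝 w₀, Λ (h w) = w :=
    HasStrictDerivAt.eventually_right_inverse hΛa.hasStrictDerivAt hΛ'
  have hhw : h w₀ = z₀ := hleft.self_of_nhds
  -- `h ∘ τ`, with `h` the local inverse of `Λ`, parametrizes the foliation line through `x` real
  -- analytically.
  set τ : ℝ → ℂ := fun s => w₀ + s * Complex.I with hτ
  have hτ0 : τ 0 = w₀ := by simp [hτ]
  have hτd (s : ℝ) : HasDerivAt τ Complex.I s := by
    simpa [hτ] using ((Complex.ofRealCLM.hasDerivAt (x := s)).mul_const Complex.I).const_add w₀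
  have hτa : AnalyticAt ℝ τ 0 :=
    analyticAt_const.add ((Complex.ofRealCLM.analyticAt 0).mul analyticAt_const)
  have hτc : Filter.Tendsto τ (𝓝 0) (𝓝 w₀) := by
    have := (hτd 0).continuousAt
    rwa [ContinuousAt, hτ0] at this
  have hσa : AnalyticAt ℝ (fun s => h (τ s)) 0 :=
    AnalyticAt.comp (g := h) (by rw [hτ0]; exact hha.restrictScalars) hτa
  have hσ0 : h (τ 0) = z₀ := by rw [hτ0, hhw]
  have hσc : Filter.Tendsto (fun s => h (τ s)) (𝓝 0) (𝓝 z₀) := by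
    have := hσa.continuousAt
    rwa [ContinuousAt, hσ0] at this
  have hγσ : AnalyticAt ℝ (fun s => γ (h (τ s))) 0 :=
    AnalyticAt.comp (g := γ) (f := fun s => h (τ s)) (by rw [hσ0]; exact hγ.restrictScalars) hσa
  have hδσ : AnalyticAt ℝ (fun s => δ (h (τ s))) 0 :=
    AnalyticAt.comp (g := δ) (f := fun s => h (τ s)) (by rw [hσ0]; exact hδ.restrictScalars) hσa
  have hga : AnalyticAt ℝ (fun s => ((starRingEnd ℂ (γ (h (τ s)))) * δ (h (τ s))).im) 0 :=
    (Complex.imCLM.analyticAt _).comp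
      (((Complex.conjCLE : ℂ →L[ℝ] ℂ).analyticAt _).comp hγσ |>.mul hδσ)
  -- The caustic equation along this line is real analytic in `s`. Either it vanishes near `0`, and
  -- a whole arc lies in the caustic, or `0` is an isolated zero.
  rcases hga.eventually_eq_zero_or_eventually_ne_zero with hg | hg
  · exfalso
    apply hnl
    have hev := ((hg.and (hσc.eventually (Metric.ball_mem_nhds z₀ hr))).and
      (hτc.eventually (hright.eventually_nhds.and hha.eventually_analyticAt)))
    obtain ⟨ε, hε, hev⟩ := Metric.eventually_nhds_iff_ball.1 hev
    -- This rescaling takes `[0, 1]` inside the interval of radius `ε`, with `x` at the midpoint `t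
    -- = 1 / 2`. On the resulting velocity `γ - δ` takes the constant value `ε i`.
    set s : ℝ → ℝ := fun t => ε * (t - 1 / 2) with hs
    have hsb : ∀ t ∈ Set.Icc (0 : ℝ) 1, s t ∈ Metric.ball (0 : ℝ) ε := by
      intro t ht
      rw [Metric.mem_ball, dist_zero_right, Real.norm_eq_abs, abs_lt]
      constructor <;> simp only [hs] <;> nlinarith [ht.1, ht.2]
    have hsd (t : ℝ) : HasDerivAt s ε t := by
      simpa only [id, mul_one] using ((hasDerivAt_id t).sub_const (1 / 2)).const_mul ε
    have hmul : ∀ t ∈ Set.Icc (0 : ℝ) 1,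
        (γ (h (τ (s t))) - δ (h (τ (s t)))) * deriv h (τ (s t)) = 1 := by
      intro t ht
      obtain ⟨⟨-, h2⟩, h3, h4⟩ := hev _ (hsb t ht)
      have h5 := (hΛd _ h2).comp (τ (s t)) h4.differentiableAt.hasDerivAt
      exact (h5.congr_of_eventuallyEq
        (show (fun w => w) =ᶠ[_] _ from h3.mono fun w hw => hw.symm)).unique (hasDerivAt_id _)
    have hval : ∀ t ∈ Set.Icc (0 : ℝ) 1, (γ (h (τ (s t))) - δ (h (τ (s t)))) *
        (deriv h (τ (s t)) * (ε • Complex.I)) = ε * Complex.I := by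
      intro t ht
      rw [← mul_assoc, hmul t ht, one_mul]
      rfl
    have hb' := fun t ht => hball _ (hev _ (hsb t ht)).1.2
    obtain ⟨L, hL⟩ := exists_leaf_of_chart (C := C) (x₀ := x₀) (z := fun t => h (τ (s t)))
      (z' := fun t => deriv h (τ (s t)) * (ε • Complex.I)) (γ := γ) (δ := δ)
      (fun t ht => (hev _ (hsb t ht)).2.2.differentiableAt.hasDerivAt.comp t
        ((hτd (s t)).scomp t (hsd t)))
      (fun t ht => (hb' t ht).1) (fun t ht => (hb' t ht).2.1)
      (fun t ht => (hb' t ht).2.2.1.continuousAt) (fun t ht => (hb' t ht).2.2.2.1.continuousAt)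
      (fun t ht => (hb' t ht).2.2.2.2.1) (fun t ht => (hb' t ht).2.2.2.2.2.1)
      (fun t ht => by rw [hval t ht]; simp) (fun t ht => by rw [hval t ht]; simpa using hε)
    refine ⟨L, 1 / 2, by norm_num, ?_, fun u hu => ?_⟩
    · rw [hL, show s (1 / 2) = 0 by simp [hs], hσ0, hz₀, (chartAt ℂ x₀).left_inv hxs]
    · have hu' := Set.Ioo_subset_Icc_self hu
      obtain ⟨h1, h2, -, -, h5, h6, -⟩ := hb' u hu'
      rw [hL]
      refine mem_caustic_of_im_conj_mul_eq_zero ((chartAt ℂ x₀).map_target h1) h2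
        (c := γ (h (τ (s u)))) (d := δ (h (τ (s u)))) ?_ ?_ ?_ (hev _ (hsb u hu')).1.1
      · rwa [C.smul_mem_fiber_iff ((chartAt ℂ x₀).map_target h1), (chartAt ℂ x₀).right_inv h1]
      · rwa [C.smul_mem_fiber_iff ((chartAt ℂ x₀).map_target h1), (chartAt ℂ x₀).right_inv h1]
      · intro heq
        have := hmul u hu'
        rw [heq] at this
        simp at this
  · rw [eventually_nhdsWithin_iff] at hg
    have hsz : Filter.Tendsto (fun z => (Λ z - w₀).im) (𝓝 z₀) (𝓝 0) := by
      have h1 : ContinuousAt (fun z => (Λ z - w₀).im) z₀ :=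
        Complex.continuous_im.continuousAt.comp (hΛa.continuousAt.sub continuousAt_const)
      have h2 : (Λ z₀ - w₀).im = 0 := by simp [hw₀]
      rwa [ContinuousAt, h2] at h1
    have hfst : Filter.Tendsto (fun q : (ℂ × ℂ) × (ℂ × ℂ) => q.1.1)
        (𝓝 (cotangentCoord x₀ x α, cotangentCoord x₀ x β)) (𝓝 z₀) :=
      (continuous_fst.comp continuous_fst).tendsto _
    have hfst' : Filter.Tendsto (fun q : (ℂ × ℂ) × (ℂ × ℂ) => q.1)
        (𝓝 (cotangentCoord x₀ x α, cotangentCoord x₀ x β)) (𝓝 (cotangentCoord x₀ x α)) :=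
      continuous_fst.tendsto _
    have hsnd : Filter.Tendsto (fun q : (ℂ × ℂ) × (ℂ × ℂ) => q.2)
        (𝓝 (cotangentCoord x₀ x α, cotangentCoord x₀ x β)) (𝓝 (cotangentCoord x₀ x β)) :=
      continuous_snd.tendsto _
    -- The neighbourhood keeps `α'` on the sheet `γ` and `β'` on `δ`, and keeps the parameter `Im (Λ
    -- - w₀)` so small that `0` is the only zero of the caustic equation.
    refine ⟨_, ((hfst'.eventually hγu).and (hsnd.eventually hδu)).and
      ((hfst.eventually hleft).and (hfst.eventually (hsz.eventually hg))), ?_⟩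
    rintro x' hx' α' hα' β' hβ' hne' hk' hre ⟨⟨h1, h2⟩, h3, h4⟩
    have hxs' : x' ∈ (chartAt ℂ x₀).source := hk'.1
    have hcα : covectorCoeff x₀ x' α' = γ (chartAt ℂ x₀ x') := h1 ((C.mem_fiber_iff hxs' _).1 hα')
    have hcβ : covectorCoeff x₀ x' β' = δ (chartAt ℂ x₀ x') := h2 ((C.mem_fiber_iff hxs' _).1 hβ')
    have hΛx : Λ (chartAt ℂ x₀ x') = k.val x' α' - l.val x' β' :=
      congrArg₂ (· - ·) (k.sheetVal_chart hxs' hcα.symm) (l.sheetVal_chart hxs' hcβ.symm)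
    have h3' : h (Λ (chartAt ℂ x₀ x')) = chartAt ℂ x₀ x' := h3
    have hτs : τ (Λ (chartAt ℂ x₀ x') - w₀).im = Λ (chartAt ℂ x₀ x') := by
      apply Complex.ext
      · simp [hτ, hΛx, hw₀v, hre]
      · simp [hτ]
    have h4' : (Λ (chartAt ℂ x₀ x') - w₀).im = 0 := by
      by_contra hs0
      refine h4 hs0 ?_
      change ((starRingEnd ℂ (γ (h (τ (Λ (chartAt ℂ x₀ x') - w₀).im)))) *
        δ (h (τ (Λ (chartAt ℂ x₀ x') - w₀).im))).im = 0
      rw [hτs, h3', ← hcα, ← hcβ]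
      exact im_conj_mul_eq_zero_of_mem_caustic hxs' hx' hα' hβ' hne'
    have hz : chartAt ℂ x₀ x' = chartAt ℂ x₀ x := by
      rw [← h3', ← hτs, h4', hσ0]
    exact (chartAt ℂ x₀).injOn hxs' hxs hz

/-- On the part of the caustic which does not run along foliation lines, the flux takes each value
only countably often. -/
lemma countable_caustic_level (hB : IsClosed C.branch) (k l : C.Patch) (r : ℝ) :
    {x | x ∈ C.caustic ∧ ¬ CausticIsLeafAt C x ∧ ∃ α ∈ C.fiber x, ∃ β ∈ C.fiber x, α ≠ β ∧
      k.Mem x α ∧ l.Mem x β ∧ (k.val x α - l.val x β).re = r}.Countable := by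
  set T : Set (Σ x, Cotangent X x × Cotangent X x) := {y | y.1 ∈ C.caustic ∧
    ¬ CausticIsLeafAt C y.1 ∧ y.2.1 ∈ C.fiber y.1 ∧ y.2.2 ∈ C.fiber y.1 ∧ y.2.1 ≠ y.2.2 ∧
    k.Mem y.1 y.2.1 ∧ l.Mem y.1 y.2.2 ∧ (k.val y.1 y.2.1 - l.val y.1 y.2.2).re = r} with hT
  have h : (Sigma.fst '' T).Countable := by
    refine countable_image_of_locally_constant T
      (fun y => (cotangentCoord k.center y.1 y.2.1, cotangentCoord k.center y.1 y.2.2)) _ ?_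
    rintro ⟨x, α, β⟩ ⟨hx, hnl, hα, hβ, hne, hk, hl, hr⟩
    obtain ⟨W, hW, hWx⟩ := exists_nhds_caustic_eq hB k l hx hnl hα hβ hne hk hl
    refine ⟨W, hW, ?_⟩
    rintro ⟨x', α', β'⟩ ⟨hx', -, hα', hβ', hne', hk', hl', hr'⟩ hy
    exact hWx x' hx' α' hα' β' hβ' hne' hk' (hr'.trans hr.symm) hy
  refine h.mono ?_
  rintro x ⟨hx, hnl, α, hα, β, hβ, hne, hk, hl, hr⟩
  exact ⟨⟨x, α, β⟩, ⟨hx, hnl, hα, hβ, hne, hk, hl, hr⟩, rfl⟩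

end SpectralCurve

/-! ### The exceptional set -/

theorem proposition2p1 {X : Type*} [TopologicalSpace X] [T2Space X] [SecondCountableTopology X]
    [ChartedSpace ℂ X] [IsManifold 𝓘(ℂ) ω X]
    (C : SpectralCurve X) (S : C.SingularSet) (hS : ¬ S.HasBPSState) :
    ∃ N : Set X, N.Countable ∧
      ∀ p ∈ C.caustic, p ∉ N → ¬ C.CausticIsLeafAt p →
        ∀ (F : Set (Cotangent X p)) (hF : C.IsFoliationAt p F),
          ¬ (S.adjoin p F hF).HasBPSState := by
  have hB : C.branch.Finite := S.finite_points.subset S.branch_subset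
  obtain ⟨P, pot, I, hP, hI, hcov, hpot, hpotS⟩ := C.exists_potential hB S.finite_points.countable
  -- The exceptional points are those where the flux of some pair of distinct sheets, computed in
  -- two of the countably many patches, lies in `P`, that is, vanishes in `ℝ ⧸ P`.
  refine ⟨⋃ k ∈ I, ⋃ l ∈ I, ⋃ r ∈ (P : Set ℝ), {x | x ∈ C.caustic ∧ ¬ C.CausticIsLeafAt x ∧
    ∃ α ∈ C.fiber x, ∃ β ∈ C.fiber x, α ≠ β ∧ k.Mem x α ∧ l.Mem x β ∧
      (k.val x α - l.val x β).re = r},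
    hI.biUnion fun k _ => hI.biUnion fun l _ => hP.biUnion fun r _ =>
      SpectralCurve.countable_caustic_level hB.isClosed k l r, ?_⟩
  intro p hp hpN hnl F hF hBPS
  obtain ⟨α, hα, β, hβ, hne, hF'⟩ := id hF
  have hflux := SpectralCurve.SingularSet.flux_eq_zero_of_hasBPSState hS
    (fun l => l.potential_sub_eq hcov hpot) hpotS hp.1 hF hF' hne hBPS
  obtain ⟨k, hk, hkm⟩ := hcov p α hα
  obtain ⟨l, hl, hlm⟩ := hcov p β hβ
  rw [hpot k hk p α hα hkm, hpot l hl p β hβ hlm, ← map_sub, Submodule.mkQ_apply,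
    Submodule.Quotient.mk_eq_zero, ← Complex.sub_re] at hflux
  exact hpN (Set.mem_biUnion hk (Set.mem_biUnion hl (Set.mem_biUnion hflux
    ⟨hp, hnl, α, hα, β, hβ, hne, hkm, hlm, rfl⟩)))
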